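/- **Setting.** Let $D\subseteq\mathbb Z^2$, $e_1=(1,0)$, $e_2=(0,1)$. Edges of $D$ are pairs of points of $D$ at distance 1, squares of $D$ are unit squares with all four vertices in $D$. Let $g:D\to\mathbb C$ be discrete holomorphic with cross ratio factorizing function $\alpha$: $g_p\ne g_q$ for adjacent $p,q$, $\alpha$ is a real function of the edges of $D$ and, for each square with vertices $p$, $q=p+e_1$, $r=p+e_1+e_2$, $s=p+e_2$, $$\frac{(g_q-g_p)(g_s-g_r)}{(g_r-g_q)(g_p-g_s)}=\frac{\alpha_{pq}}{\alpha_{ps}}<0,\qquad \alpha_{pq}=\alpha_{sr},\quad \alpha_{ps}=\alpha_{qr}.$$ Let $\lambda\in\mathbb R\setminus\{0\}$ with $\lambda\alpha>0$ on horizontal and $\lambda\alpha<0$ on vertical edges. Let $E$ assign to each $p\in D$ a complex $2\times2$ matrix such that $$E_q-E_p=E_p\begin{pmatrix}0&g_q-g_p\\ \frac{\lambda\alpha_{pq}}{g_q-g_p}&0\end{pmatrix}$$ for all edges $pq$ of $D$ with $q\in\{p+e_1,p+e_2\}$. Put $$f_p=\tfrac1{\det E_p}E_p\overline{E_p}^T,\quad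 N_p=\tfrac1{\det E_p}E_p\begin{pmatrix}1&0\\0&-1\end{pmatrix}\overline{E_p}^T,\quad f^d_p=\cosh(\log d)f_p-\sinh(\log d)N_p\ (d>0),$$ and assume $f_p\in\mathbb H^3=\{X \text{ Hermitian } 2\times 2: \operatorname{tr}X>0,\ \det X=1\}$ for all $p\in D$. Thus $f$ is a discrete flat surface in $\mathbb H^3$ with normal $N$ and parallel surfaces $f^d$. The normal geodesic at $p$ is $\ell_p=\{\cosh t\, f_p+\sinh t\, N_p:t\in\mathbb R\}$. The caustic $C_f$ has as vertex at each vertical edge $pq$ of $D$ the intersection point $(C_f)_{pq}$ of $\ell_p$ and $\ell_q$. For each horizontal edge $h=pq$, $q=p+e_1$, such that $p\pm e_2,q\pm e_2\in D$, it has the face $\mathcal F_h$, the planar geodesic quadrilateral with successive vertices $(C_f)_{p-e_2,p},\ (C_f)_{q-e_2,q},\ (C_f)_{q,q+e_2},\ (C_f)_{p,p+e_2}$. A side of $\mathcal F_h$ is a *boundary side* if it is not shared with the face at the corresponding neighbouring horizontal edge ($h\pm e_2$ for the sides joining $\ell_p$ and $\ell_q$, $h\pm e_1$ for the sides on $\ell_q$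 and $\ell_p$), i.e. if $C_f$ has no face there. A quadrilateral is *embedded* if its sides meet only in the common endpoints of consecutive sides. Let $S_d$ be the set of all points $P\in\mathbb H^3$ such that, for some horizontal edge $h=pq$ of $D$ with a face $\mathcal F_h$, $P$ lies in $\mathcal F_h$ and in the geodesic segment $\overline{f^d_pf^d_q}$. **Theorem.** Assume that for every square of $D$ the quadrilateral in $\mathbb C$ with successive vertices $g_p,g_q,g_r,g_s$ is embedded, that all faces of $C_f$ are embedded, and that $f^d_p\neq f^d_q$ for all adjacent $p,q\in D$. Then $S_d$ is a graph in the combinatorial sense whose edges are geodesic segments lying in the horizontal edges of $f^d$. Precisely, there is a multigraph $G$, with a horizontal edge $h(i)$ of $D$ assigned to every edge $i$ of $G$, such that 1. the vertices of $G$ are points of $S_d$, each is an end of some edge, and the two ends of every edge are distinct; 2. $S_d$ is the union of the geodesic segments between the ends of the edges of $G$; moreover, for every $h=pq$ with a face, $\mathcal F_h\cap\overline{f^d_pf^d_q}$ is the union of the segments of the edges $i$ with $h(i)=h$; these are finite in number, and any two of them meet at most in common ends (segments belonging to different horizontal edges may cross); if $h$ has no face, there is no edge with $h(i)=h$; 3.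 a vertex $v$ has valence at least two whenever it is an end of some edge $i$ of $G$ such that $v$ does not lie on a boundary side of $\mathcal F_{h(i)}$. In particular, all vertices that do not lie on the boundary of the caustic have valence at least two, and for $D=\mathbb Z^2$ all vertices have valence at least two. -/

import Mathlib

namespace DiscreteFlat

open Matrix

/-- Complex `2 × 2` matrices; its Hermitian elements form the Minkowski space `ℝ^{3,1}`, with
squared norm `-det`. -/
abbrev M2 : Type := Matrix (Fin 2) (Fin 2) ℂ

/-- Vertices of the square lattice. -/
abbrev Lattice : Type := ℤ × ℤ

/-- The horizontal unit step. -/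
def e₁ : Lattice := (1, 0)

/-- The vertical unit step. -/
def e₂ : Lattice := (0, 1)

/-! ### Hyperbolic space, geodesic segments, quadrilaterals -/

/-- Hyperbolic 3-space, in the Hermitian matrix model. -/
def H3 : Set M2 := {X | X.IsHermitian ∧ 0 < X.trace.re ∧ X.det = 1}

/-- The geodesic segment of `H3` between two points `x`, `y` of `H3`. -/
def geoSegment (x y : M2) : Set M2 :=
  {z | z ∈ H3 ∧ ∃ s t : ℝ, 0 ≤ s ∧ 0 ≤ t ∧ z = s • x + t • y}

/-- The (filled) geodesic triangle of `H3` with vertices `x`, `y`, `z` in `H3`. -/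
def geoTriangle (x y z : M2) : Set M2 :=
  {w | w ∈ H3 ∧ ∃ r s t : ℝ, 0 ≤ r ∧ 0 ≤ s ∧ 0 ≤ t ∧ w = r • x + s • y + t • z}

/-- The quadrilateral with vertices `a`, `b`, `c`, `d` in this cyclic order is embedded: its sides
(given by `seg`) meet only in the common endpoints of consecutive sides. -/
def EmbeddedQuad {X : Type*} (seg : X → X → Set X) (a b c d : X) : Prop :=
  seg a b ∩ seg c d = ∅ ∧ seg b c ∩ seg d a = ∅ ∧
  seg a b ∩ seg b c = {b} ∧ seg b c ∩ seg c d = {c} ∧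
  seg c d ∩ seg d a = {d} ∧ seg d a ∩ seg a b = {a}

/-- The closed region of a geodesic plane bounded by the embedded geodesic quadrilateral with
vertices `a`, `b`, `c`, `d` in this cyclic order. An embedded planar quadrilateral is cut by one of
its two diagonals into two triangles. If it is convex, each diagonal does so; if it has a reflex
vertex, the diagonal from that vertex does so, and the two triangles on the other diagonal cover
the convex hull. In all cases the region is the following intersection. -/
def quadRegion (a b c d : M2) : Set M2 :=
  (geoTriangle a b c ∪ geoTriangle a c d) ∩ (geoTriangle a b d ∪ geoTriangle b c d)

/-! ### Discrete holomorphic functions -/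

/-- The unit square with lower left corner `p` has its vertices in `D`. -/
def HasSquare (D : Set Lattice) (p : Lattice) : Prop :=
  p ∈ D ∧ p + e₁ ∈ D ∧ p + e₁ + e₂ ∈ D ∧ p + e₂ ∈ D

/-- The cross ratio of `g` on the unit square with lower left corner `p`. -/
noncomputable def crossRatio (g : Lattice → ℂ) (p : Lattice) : ℂ :=
  (g (p + e₁) - g p) * (g (p + e₁ + e₂) - g (p + e₁))⁻¹ *
    (g (p + e₂) - g (p + e₁ + e₂)) * (g p - g (p + e₂))⁻¹

/-- `α`, a real function of the (unoriented) edges of `D`, is a cross ratio factorizing function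
of `g`. -/
def IsCrossRatioFactorizing (D : Set Lattice) (g : Lattice → ℂ) (α : Sym2 Lattice → ℝ) : Prop :=
  ∀ p, HasSquare D p →
    crossRatio g p = ((α s(p, p + e₁) / α s(p, p + e₂) : ℝ) : ℂ) ∧
    α s(p, p + e₁) / α s(p, p + e₂) < 0 ∧
    α s(p, p + e₁) = α s(p + e₂, p + e₁ + e₂) ∧
    α s(p, p + e₂) = α s(p + e₁, p + e₁ + e₂)

/-- `q` is the next vertex of `p`, to the right or upwards. -/
def IsStep (p q : Lattice) : Prop := q = p + e₁ ∨ q = p + e₂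

/-- All quadrilaterals in the image of `g` are embedded in the complex plane. -/
def HasEmbeddedQuads (D : Set Lattice) (g : Lattice → ℂ) : Prop :=
  ∀ p, HasSquare D p →
    EmbeddedQuad (segment ℝ) (g p) (g (p + e₁)) (g (p + e₁ + e₂)) (g (p + e₂))

/-! ### Discrete flat surfaces, normals, parallel surfaces -/

/-- `E` solves the discrete linear system of a discrete flat surface. The edges are traversed
rightwards and upwards; traversing them backwards changes `E` by a real scalar. -/
def IsLift (D : Set Lattice) (g : Lattice → ℂ) (α : Sym2 Lattice → ℝ) (lam : ℝ)
    (E : Lattice → M2) : Prop :=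
  ∀ p ∈ D, ∀ q ∈ D, IsStep p q →
    E q - E p = E p * !![0, g q - g p; ((lam * α s(p, q) : ℝ) : ℂ) / (g q - g p), 0]

/-- The discrete flat surface with lift `E`. -/
noncomputable def surface (E : Lattice → M2) (p : Lattice) : M2 :=
  (E p).det⁻¹ • (E p * (E p)ᴴ)

/-- The normal at a vertex of the discrete flat surface with lift `E`. -/
noncomputable def normal (E : Lattice → M2) (p : Lattice) : M2 :=
  (E p).det⁻¹ • (E p * !![1, 0; 0, -1] * (E p)ᴴ)

/-- The parallel surface `f^d`. -/
noncomputable def parallel (E : Lattice → M2) (d : ℝ) (p : Lattice) : M2 :=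
  Real.cosh (Real.log d) • surface E p - Real.sinh (Real.log d) • normal E p

/-- The normal geodesic at the vertex `p`. -/
def normalGeodesic (E : Lattice → M2) (p : Lattice) : Set M2 :=
  {z | ∃ t : ℝ, z = Real.cosh t • surface E p + Real.sinh t • normal E p}

/-! ### The caustic -/

/-- The vertex of the caustic that belongs to the vertical edge from `p` to `p + e₂`: the
intersection point of the two normal geodesics. -/
noncomputable def caustic (E : Lattice → M2) (p : Lattice) : M2 :=
  Classical.epsilon fun z => z ∈ normalGeodesic E p ∩ normalGeodesic E (p + e₂)

/-- The caustic of a surface over `D` has a face at the horizontal edge from `p` to `p + e₁`: the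
four vertical edges at `p` and at `p + e₁` are edges of `D`. -/
def HasFace (D : Set Lattice) (p : Lattice) : Prop :=
  p - e₂ ∈ D ∧ p ∈ D ∧ p + e₂ ∈ D ∧ p + e₁ - e₂ ∈ D ∧ p + e₁ ∈ D ∧ p + e₁ + e₂ ∈ D

/-- The face of the caustic at the horizontal edge from `p` to `p + e₁` is embedded. -/
def FaceEmbedded (E : Lattice → M2) (p : Lattice) : Prop :=
  EmbeddedQuad geoSegment
    (caustic E (p - e₂)) (caustic E (p + e₁ - e₂)) (caustic E (p + e₁)) (caustic E p)

/-- The face of the caustic at the horizontal edge from `p` to `p + e₁`. -/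
noncomputable def face (E : Lattice → M2) (p : Lattice) : Set M2 :=
  quadRegion
    (caustic E (p - e₂)) (caustic E (p + e₁ - e₂)) (caustic E (p + e₁)) (caustic E p)

/-- The points on those sides of the face at the horizontal edge from `p` to `p + e₁` that are
boundary edges of the caustic, i.e. that are not shared with the adjacent face. The four
alternatives are the sides to the faces below, above, to the left and to the right. -/
def faceBoundary (D : Set Lattice) (E : Lattice → M2) (p : Lattice) : Set M2 :=
  {z | (¬ HasFace D (p - e₂) ∧ z ∈ geoSegment (caustic E (p - e₂)) (caustic E (p + e₁ - e₂))) ∨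
       (¬ HasFace D (p + e₂) ∧ z ∈ geoSegment (caustic E p) (caustic E (p + e₁))) ∨
       (¬ HasFace D (p - e₁) ∧ z ∈ geoSegment (caustic E (p - e₂)) (caustic E p)) ∨
       (¬ HasFace D (p + e₁) ∧ z ∈ geoSegment (caustic E (p + e₁ - e₂)) (caustic E (p + e₁)))}

/-! ### The set `S_d` and graphs made of geodesic segments -/

/-- The part of `S_d` at the horizontal edge from `p` to `p + e₁`: the points of the corresponding
edge of `f^d` that lie in the corresponding face of the caustic. -/
def singularPart (D : Set Lattice) (E : Lattice → M2) (d : ℝ) (p : Lattice) : Set M2 :=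
  {z | HasFace D p ∧ z ∈ geoSegment (parallel E d p) (parallel E d (p + e₁)) ∧ z ∈ face E p}

/-- The set `S_d`: the points that lie in the face of the caustic and in the edge of `f^d` at one
and the same horizontal edge of `D`. -/
def singularSet (D : Set Lattice) (E : Lattice → M2) (d : ℝ) : Set M2 :=
  {z | ∃ p, z ∈ singularPart D E d p}

/-- The multigraph `G`, whose vertices are points of `S`, is a graph structure on the set `S`,
compatible with its parts `part k`: `S` is the union of the geodesic segments between the two
distinct ends of the edges of `G`; the edges with label `k` are finite in number, make up the set
`part k`, and meet each other only in common ends; and every vertex is an end of an edge. Segments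
with different labels may cross each other, as in an immersed graph. -/
structure IsGeodesicGraph {κ ι : Type} (S : Set M2) (part : κ → Set M2) (G : Graph M2 ι)
    (lab : ι → κ) : Prop where
  vertex_mem : G.vertexSet ⊆ S
  ends_ne : ∀ i x y, G.IsLink i x y → x ≠ y
  union_eq : S = {z | ∃ i x y, G.IsLink i x y ∧ z ∈ geoSegment x y}
  part_eq : ∀ k, part k = {z | ∃ i x y, G.IsLink i x y ∧ lab i = k ∧ z ∈ geoSegment x y}
  finite : ∀ k, {i | i ∈ G.edgeSet ∧ lab i = k}.Finite
  inter : ∀ i j x y x' y', G.IsLink i x y → G.IsLink j x' y' → i ≠ j → lab i = lab j →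
    geoSegment x y ∩ geoSegment x' y' ⊆ {x, y} ∩ {x', y'}
  not_isolated : ∀ v ∈ G.vertexSet, (G.incidenceSet v).Nonempty

end DiscreteFlat

/-! A point of `H3` is replaced by its ray of positive definite matrices; segments and triangles
become convex cones, and the geometry becomes linear algebra. A normal geodesic has two isotropic
ends n₁, n₂, and its points are the rays of x n₁ + n₂ with x = e^{2t} (`geodesic_eq`). Across an
edge both ends move along one vector w, by m w and ρ w, where m = λα and ρ = |Δg|² (`ends_of_edge`).
Hence the points with parameter x on neighbouring geodesics differ by (ρ + m x) w. On a vertical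
edge m < 0, and the geodesics meet at x = -ρ/m, the same parameter on both. On a horizontal edge m >
0, and they bound a strip. All vertices of f^d have the one parameter v = d⁻².

Let a face have the parameters u, x on its left geodesic and u', x' on its right one. Embeddedness
forces x - u and x' - u' to have the same sign (`same_direction_of_embedded`), so the face is
convex. Distinctness of the ends of vertical edges of f^d says that v differs from all four
parameters. Round the face, v minus the parameter changes sign along zero or two sides: the number
is even, and four would contradict the common direction. The edge of f^d has an end of its part in
the face on exactly the sides with a sign change, so it misses the face or cuts out a nondegenerate
segment (`strip_inter_eq`, `singularPart_eq`).

The graph has one edge for each face that is met. Whether a side carries an end, and at which point,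
depends only on v and the vertices of this side, so the face across a shared side has the same end
(`exists_adjacent_faceEnd`). This gives valence two. -/

namespace DiscreteFlat

open Matrix
open scoped ComplexOrder

/-! ### Convex cones, and clipping a segment by two linear inequalities. -/

section Cones

variable {V : Type*} [AddCommGroup V] [Module ℝ V]

/-- The convex cone generated by two vectors. -/
def cone2 (x y : V) : Set V :=
  {z | ∃ s t : ℝ, 0 ≤ s ∧ 0 ≤ t ∧ z = s • x + t • y}

/-- The convex cone generated by three vectors. -/
def cone3 (x y z : V) : Set V :=
  {w | ∃ r s t : ℝ, 0 ≤ r ∧ 0 ≤ s ∧ 0 ≤ t ∧ w = r • x + s • y + t • z}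

/-- The convex cone generated by four vectors. -/
def cone4 (a b c d : V) : Set V :=
  {w | ∃ r s t u : ℝ, 0 ≤ r ∧ 0 ≤ s ∧ 0 ≤ t ∧ 0 ≤ u ∧ w = r • a + s • b + t • c + u • d}

theorem cone2_comm (x y : V) : cone2 x y = cone2 y x := by
  ext z
  constructor <;> rintro ⟨s, t, hs, ht, rfl⟩ <;> exact ⟨t, s, ht, hs, add_comm _ _⟩

theorem cone2_smul {c d : ℝ} (hc : 0 < c) (hd : 0 < d) (x y : V) :
    cone2 (c • x) (d • y) = cone2 x y := by
  ext z
  constructor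
  · rintro ⟨s, t, hs, ht, rfl⟩
    exact ⟨s * c, t * d, by positivity, by positivity, by simp only [mul_smul]⟩
  · rintro ⟨s, t, hs, ht, rfl⟩
    refine ⟨s / c, t / d, by positivity, by positivity, ?_⟩
    simp only [smul_smul, div_mul_cancel₀ _ hc.ne', div_mul_cancel₀ _ hd.ne']

theorem cone3_smul {c d e : ℝ} (hc : 0 < c) (hd : 0 < d) (he : 0 < e) (x y z : V) :
    cone3 (c • x) (d • y) (e • z) = cone3 x y z := by
  ext w
  constructor
  · rintro ⟨r, s, t, hr, hs, ht, rfl⟩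
    exact ⟨r * c, s * d, t * e, by positivity, by positivity, by positivity,
      by simp only [mul_smul]⟩
  · rintro ⟨r, s, t, hr, hs, ht, rfl⟩
    refine ⟨r / c, s / d, t / e, by positivity, by positivity, by positivity, ?_⟩
    simp only [smul_smul, div_mul_cancel₀ _ hc.ne', div_mul_cancel₀ _ hd.ne',
      div_mul_cancel₀ _ he.ne']

theorem cone4_reverse (a b c d : V) : cone4 a b c d = cone4 d c b a := by
  ext z
  constructor <;> rintro ⟨r, s, t, u, hr, hs, ht, hu, rfl⟩ <;>
    exact ⟨u, t, s, r, hu, ht, hs, hr, by abel⟩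

theorem cone4_convex {a b c d x y : V} (hx : x ∈ cone4 a b c d) (hy : y ∈ cone4 a b c d)
    {s t : ℝ} (hs : 0 ≤ s) (ht : 0 ≤ t) : s • x + t • y ∈ cone4 a b c d := by
  obtain ⟨p, q, r, u, hp, hq, hr, hu, rfl⟩ := hx
  obtain ⟨p', q', r', u', hp', hq', hr', hu', rfl⟩ := hy
  exact ⟨s * p + t * p', s * q + t * q', s * r + t * r', s * u + t * u', by positivity,
    by positivity, by positivity, by positivity, by module⟩

/-- If the open cones over the two diagonals of a quadrilateral meet, then the cone over the
quadrilateral is cut into two triangular cones by the first diagonal. -/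
theorem cone4_eq_union {a b c d : V} {k₁ k₂ k₃ k₄ : ℝ} (h₁ : 0 < k₁) (h₂ : 0 < k₂)
    (h₃ : 0 < k₃) (h₄ : 0 < k₄) (h : k₁ • a + k₃ • c = k₂ • b + k₄ • d) :
    cone3 a b c ∪ cone3 a c d = cone4 a b c d := by
  ext z
  constructor
  · rintro (⟨r, s, t, hr, hs, ht, rfl⟩ | ⟨r, s, t, hr, hs, ht, rfl⟩)
    · exact ⟨r, s, t, 0, hr, hs, ht, le_rfl, by module⟩
    · exact ⟨r, 0, s, t, hr, le_rfl, hs, ht, by module⟩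
  · rintro ⟨r, s, t, u, hr, hs, ht, hu, rfl⟩
    have e : ∀ τ : ℝ, τ • (k₁ • a + k₃ • c - (k₂ • b + k₄ • d)) = 0 := fun τ => by
      rw [sub_eq_zero.2 h, smul_zero]
    -- The relation is applied min(s/k₂, u/k₄) times; it trades b and d for a and c until one of b,
    -- d is used up.
    rcases le_total (s / k₂) (u / k₄) with hle | hle
    · right
      refine ⟨r + s / k₂ * k₁, t + s / k₂ * k₃, u - s / k₂ * k₄, by positivity, by positivity,
        ?_, ?_⟩
      · rw [le_div_iff₀ h₄] at hle; linarith
      · have hs' : s = s / k₂ * k₂ := by field_simp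
        rw [← sub_eq_zero, ← neg_eq_zero, ← e (s / k₂)]
        nth_rewrite 1 [hs']
        module
    · left
      refine ⟨r + u / k₄ * k₁, s - u / k₄ * k₂, t + u / k₄ * k₃, by positivity, ?_,
        by positivity, ?_⟩
      · rw [le_div_iff₀ h₂] at hle; linarith
      · have hs' : u = u / k₄ * k₄ := by field_simp
        rw [← sub_eq_zero, ← neg_eq_zero, ← e (u / k₄)]
        nth_rewrite 1 [hs']
        module

/-- The relation is symmetric under rotating the quadrilateral, so either diagonal cuts the same
cone into two triangles. -/
theorem cone4_eq_inter {a b c d : V} {k₁ k₂ k₃ k₄ : ℝ} (h₁ : 0 < k₁) (h₂ : 0 < k₂)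
    (h₃ : 0 < k₃) (h₄ : 0 < k₄) (h : k₁ • a + k₃ • c = k₂ • b + k₄ • d) :
    (cone3 a b c ∪ cone3 a c d) ∩ (cone3 a b d ∪ cone3 b c d) = cone4 a b c d := by
  have e : cone3 a b d ∪ cone3 b c d = cone4 a b c d := by
    have h' : k₂ • b + k₄ • d = k₃ • c + k₁ • a := by rw [← h, add_comm]
    have := cone4_eq_union h₂ h₃ h₄ h₁ h'
    have e₁ : cone3 a b d = cone3 b d a := by
      ext z
      constructor
      · rintro ⟨r, s, t, hr, hs, ht, rfl⟩; exact ⟨s, t, r, hs, ht, hr, by abel⟩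
      · rintro ⟨r, s, t, hr, hs, ht, rfl⟩; exact ⟨t, r, s, ht, hr, hs, by abel⟩
    have e₂ : cone4 b c d a = cone4 a b c d := by
      ext z
      constructor
      · rintro ⟨r, s, t, u, hr, hs, ht, hu, rfl⟩; exact ⟨u, r, s, t, hu, hr, hs, ht, by abel⟩
      · rintro ⟨r, s, t, u, hr, hs, ht, hu, rfl⟩; exact ⟨s, t, u, r, hs, ht, hu, hr, by abel⟩
    rw [e₁, Set.union_comm, this, e₂]
  rw [cone4_eq_union h₁ h₂ h₃ h₄ h, e, Set.inter_self]

theorem linearIndependent_pair_of_det_pos {P Q : V} (hPQ : LinearIndependent ℝ ![P, Q])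
    {x y x' y' : ℝ} (h : 0 < x * y' - y * x') :
    LinearIndependent ℝ ![x • P + y • Q, x' • P + y' • Q] := by
  rw [LinearIndependent.pair_iff] at hPQ ⊢
  intro s t hst
  obtain ⟨h₁, h₂⟩ := hPQ (s * x + t * x') (s * y + t * y') (by rw [← hst]; module)
  have e₁ : (x * y' - y * x') * s = 0 := by linear_combination y' * h₁ - x' * h₂
  have e₂ : (x * y' - y * x') * t = 0 := by linear_combination x * h₂ - y * h₁
  exact ⟨(mul_eq_zero.1 e₁).resolve_left h.ne', (mul_eq_zero.1 e₂).resolve_left h.ne'⟩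

/-- The possible ends of the part of the segment `PQ` cut out by two linear inequalities, with
values `a`, `b` at `P` and `a'`, `b'` at `Q`. -/
def ClipEnd (P Q : V) (a a' b b' : ℝ) (x : V) : Prop :=
  (0 < a * b ∧ x = P) ∨ (0 < a' * b' ∧ x = Q) ∨
    (a * a' < 0 ∧ x = |a'| • P + |a| • Q) ∨ (b * b' < 0 ∧ x = |b'| • P + |b| • Q)

/-- Coefficients of the first end of the clipped segment. -/
def LowEnd (a a' b b' x y : ℝ) : Prop :=
  (0 < a ∧ 0 < b ∧ x = 1 ∧ y = 0) ∨ (a < 0 ∧ 0 < a' ∧ 0 < b ∧ x = a' ∧ y = -a) ∨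
    (b < 0 ∧ 0 < b' ∧ 0 < a ∧ x = b' ∧ y = -b)

/-- By `h0`, at most one inequality fails at the starting point. If one fails, it holds at the other
end, and the clipped segment starts where its form vanishes. -/
theorem exists_lowEnd {a a' b b' : ℝ} (ha : a ≠ 0) (hb : b ≠ 0)
    (h0 : 0 < a ∨ 0 < b) (hA : 0 < a ∨ 0 < a') (hB : 0 < b ∨ 0 < b') :
    ∃ x y, LowEnd a a' b b' x y := by
  rcases ha.lt_or_gt with ha | ha
  · exact ⟨_, _, .inr (.inl ⟨ha, hA.resolve_left ha.not_gt, h0.resolve_left ha.not_gt, rfl, rfl⟩)⟩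
  rcases hb.lt_or_gt with hb | hb
  · exact ⟨_, _, .inr (.inr ⟨hb, hB.resolve_left hb.not_gt, ha, rfl, rfl⟩)⟩
  · exact ⟨_, _, .inl ⟨ha, hb, rfl, rfl⟩⟩

theorem LowEnd.nonneg {a a' b b' x y : ℝ} (h : LowEnd a a' b b' x y) : 0 ≤ x ∧ 0 ≤ y := by
  rcases h with ⟨_, _, rfl, rfl⟩ | ⟨h₁, h₂, _, rfl, rfl⟩ | ⟨h₁, h₂, _, rfl, rfl⟩
  · norm_num
  · exact ⟨h₂.le, by linarith⟩
  · exact ⟨h₂.le, by linarith⟩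

/-- The determinant orders points along the segment: no point satisfying both inequalities precedes
the low end. -/
theorem LowEnd.det_nonneg {a a' b b' x y s t : ℝ} (h : LowEnd a a' b b' x y) (ht : 0 ≤ t)
    (hA : 0 ≤ s * a + t * a') (hB : 0 ≤ s * b + t * b') : 0 ≤ x * t - y * s := by
  rcases h with ⟨_, _, rfl, rfl⟩ | ⟨h₁, h₂, _, rfl, rfl⟩ | ⟨h₁, h₂, _, rfl, rfl⟩ <;> linarith

/-- The first end strictly precedes the last one, which is the low end seen from the other side.
`h₁` and `h₂` matter only if the two ends are cut by different inequalities; they compare the two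
crossings. -/
theorem LowEnd.det_pos {a a' b b' x y x' y' : ℝ} (h : LowEnd a a' b b' x y)
    (h' : LowEnd a' a b' b y' x') (h₁ : a < 0 → b' < 0 → a * b' < a' * b)
    (h₂ : b < 0 → a' < 0 → b * a' < b' * a) : 0 < x * y' - y * x' := by
  rcases h with ⟨k₁, k₂, rfl, rfl⟩ | ⟨k₁, k₂, k₃, rfl, rfl⟩ | ⟨k₁, k₂, k₃, rfl, rfl⟩ <;>
  rcases h' with ⟨l₁, l₂, rfl, rfl⟩ | ⟨l₁, l₂, l₃, rfl, rfl⟩ | ⟨l₁, l₂, l₃, rfl, rfl⟩ <;>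
  first
    | linarith
    | linarith [h₁ ‹_› ‹_›]
    | linarith [h₂ ‹_› ‹_›]

theorem LowEnd.clipEnd {a a' b b' x y : ℝ} (h : LowEnd a a' b b' x y) (P Q : V) :
    ClipEnd P Q a a' b b' (x • P + y • Q) := by
  rcases h with ⟨k₁, k₂, rfl, rfl⟩ | ⟨k₁, k₂, k₃, rfl, rfl⟩ | ⟨k₁, k₂, k₃, rfl, rfl⟩
  · exact .inl ⟨by positivity, by module⟩
  · exact .inr (.inr (.inl ⟨mul_neg_of_neg_of_pos k₁ k₂, by
      rw [abs_of_neg k₁, abs_of_pos k₂]⟩))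
  · exact .inr (.inr (.inr ⟨mul_neg_of_neg_of_pos k₁ k₂, by
      rw [abs_of_neg k₁, abs_of_pos k₂]⟩))

theorem ClipEnd.swap {P Q : V} {a a' b b' : ℝ} {x : V} (h : ClipEnd P Q a a' b b' x) :
    ClipEnd Q P a' a b' b x := by
  rcases h with h | h | ⟨h, rfl⟩ | ⟨h, rfl⟩
  · exact .inr (.inl h)
  · exact .inl h
  · exact .inr (.inr (.inl ⟨by rwa [mul_comm], add_comm _ _⟩))
  · exact .inr (.inr (.inr ⟨by rwa [mul_comm], add_comm _ _⟩))

/-- A sign change of a form is an entry or an exit, according to which of its values is negative,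
and the alternatives of `LowEnd` exclude each other; so there is no third end. -/
theorem ClipEnd.eq_or_eq {P Q : V} {a a' b b' x y x' y' : ℝ} (h : LowEnd a a' b b' x y)
    (h' : LowEnd a' a b' b y' x') {z : V} (hz : ClipEnd P Q a a' b b' z) :
    z = x • P + y • Q ∨ z = x' • P + y' • Q := by
  have key : ∀ {a b : ℝ}, a * b < 0 → (a < 0 ∧ 0 < b) ∨ (b < 0 ∧ 0 < a) := fun h => by
    rcases mul_neg_iff.1 h with h | h
    · exact .inr h.symm
    · exact .inl h
  rcases hz with ⟨hz, rfl⟩ | ⟨hz, rfl⟩ | ⟨hz, rfl⟩ | ⟨hz, rfl⟩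
  · left
    rcases h with ⟨k₁, k₂, rfl, rfl⟩ | ⟨k₁, k₂, k₃, rfl, rfl⟩ | ⟨k₁, k₂, k₃, rfl, rfl⟩
    · module
    · nlinarith
    · nlinarith
  · right
    rcases h' with ⟨k₁, k₂, rfl, rfl⟩ | ⟨k₁, k₂, k₃, rfl, rfl⟩ | ⟨k₁, k₂, k₃, rfl, rfl⟩
    · module
    · nlinarith
    · nlinarith
  · rcases key hz with ⟨k₁, k₂⟩ | ⟨k₁, k₂⟩
    · left
      rcases h with h | ⟨_, _, _, rfl, rfl⟩ | h
      · exact absurd h.1 k₁.not_gt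
      · rw [abs_of_neg k₁, abs_of_pos k₂]
      · exact absurd h.2.2.1 k₁.not_gt
    · right
      rcases h' with h | ⟨_, _, _, rfl, rfl⟩ | h
      · exact absurd h.1 k₁.not_gt
      · rw [abs_of_neg k₁, abs_of_pos k₂]
      · exact absurd h.2.2.1 k₁.not_gt
  · rcases key hz with ⟨k₁, k₂⟩ | ⟨k₁, k₂⟩
    · left
      rcases h with h | h | ⟨_, _, _, rfl, rfl⟩
      · exact absurd h.2.1 k₁.not_gt
      · exact absurd h.2.2.1 k₁.not_gt
      · rw [abs_of_neg k₁, abs_of_pos k₂]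
    · right
      rcases h' with h | h | ⟨_, _, _, rfl, rfl⟩
      · exact absurd h.2.1 k₁.not_gt
      · exact absurd h.2.2.1 k₁.not_gt
      · rw [abs_of_neg k₁, abs_of_pos k₂]

/-- A segment clipped by two inequalities, none of whose bounding lines passes through an end of
the segment, is empty or a nondegenerate segment, with the expected ends. -/
theorem cone2_inter_eq {P Q : V} {S : Set V} {a a' b b' : ℝ}
    (hPQ : LinearIndependent ℝ ![P, Q]) (ha : a ≠ 0) (ha' : a' ≠ 0) (hb : b ≠ 0) (hb' : b' ≠ 0)
    (hconv : ∀ x ∈ S, ∀ y ∈ S, ∀ s t : ℝ, 0 ≤ s → 0 ≤ t → s • x + t • y ∈ S)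
    (hS : ∀ s t : ℝ, 0 ≤ s → 0 ≤ t → s • P + t • Q ∈ S →
      0 ≤ s * a + t * a' ∧ 0 ≤ s * b + t * b')
    (hend : ∀ x, (0 < a ∨ 0 < a') → (0 < b ∨ 0 < b') → ClipEnd P Q a a' b b' x → x ∈ S)
    (h0 : 0 < a ∨ 0 < b) (h0' : 0 < a' ∨ 0 < b')
    (h₁ : a < 0 → b' < 0 → a * b' < a' * b) (h₂ : b < 0 → a' < 0 → b * a' < b' * a) :
    ((∀ x, ¬ ClipEnd P Q a a' b b' x) ∧ ∀ z ∈ cone2 P Q ∩ S, z = 0) ∨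
      ∃ l h, LinearIndependent ℝ ![l, h] ∧ cone2 P Q ∩ S = cone2 l h ∧
        ∀ x, ClipEnd P Q a a' b b' x ↔ x = l ∨ x = h := by
  have zero : ∀ {a a' s t : ℝ}, a < 0 → a' < 0 → 0 ≤ s → 0 ≤ t → 0 ≤ s * a + t * a' →
      s = 0 ∧ t = 0 := by
    intro a a' s t ha ha' hs ht h
    have k₁ : s * a ≤ 0 := mul_nonpos_of_nonneg_of_nonpos hs ha.le
    have k₂ : t * a' ≤ 0 := mul_nonpos_of_nonneg_of_nonpos ht ha'.le
    exact ⟨(mul_eq_zero.1 (by linarith : s * a = 0)).resolve_right ha.ne,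
      (mul_eq_zero.1 (by linarith : t * a' = 0)).resolve_right ha'.ne⟩
  -- A form negative at both ends leaves only zero. By `h0` and `h0'` the other form is then
  -- positive at both, so no alternative of `ClipEnd` holds.
  by_cases hA : 0 < a ∨ 0 < a'
  swap
  · left
    push Not at hA
    have ka := lt_of_le_of_ne hA.1 ha
    have ka' := lt_of_le_of_ne hA.2 ha'
    have kb := h0.resolve_left ka.not_gt
    have kb' := h0'.resolve_left ka'.not_gt
    refine ⟨fun x => ?_, ?_⟩
    · rintro (⟨h, _⟩ | ⟨h, _⟩ | ⟨h, _⟩ | ⟨h, _⟩) <;> nlinarith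
    · rintro _ ⟨⟨s, t, hs, ht, rfl⟩, h⟩
      obtain ⟨rfl, rfl⟩ := zero ka ka' hs ht (hS s t hs ht h).1
      module
  by_cases hB : 0 < b ∨ 0 < b'
  swap
  · left
    push Not at hB
    have kb := lt_of_le_of_ne hB.1 hb
    have kb' := lt_of_le_of_ne hB.2 hb'
    have ka := h0.resolve_right kb.not_gt
    have ka' := h0'.resolve_right kb'.not_gt
    refine ⟨fun x => ?_, ?_⟩
    · rintro (⟨h, _⟩ | ⟨h, _⟩ | ⟨h, _⟩ | ⟨h, _⟩) <;> nlinarith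
    · rintro _ ⟨⟨s, t, hs, ht, rfl⟩, h⟩
      obtain ⟨rfl, rfl⟩ := zero kb kb' hs ht (hS s t hs ht h).2
      module
  right
  obtain ⟨x, y, hl⟩ := exists_lowEnd ha hb h0 hA hB
  obtain ⟨y', x', hh⟩ := exists_lowEnd ha' hb' h0' hA.symm hB.symm
  have det := hl.det_pos hh h₁ h₂
  have el := hl.clipEnd P Q
  have eh : ClipEnd P Q a a' b b' (x' • P + y' • Q) := by
    rw [add_comm]; exact (hh.clipEnd Q P).swap
  refine ⟨x • P + y • Q, x' • P + y' • Q, linearIndependent_pair_of_det_pos hPQ det, ?_,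
    fun z => ⟨fun hz => hz.eq_or_eq hl hh, ?_⟩⟩
  · ext z
    constructor
    · rintro ⟨⟨s, t, hs, ht, rfl⟩, h⟩
      obtain ⟨kA, kB⟩ := hS s t hs ht h
      have d₁ := hl.det_nonneg ht kA kB
      have d₂ := hh.det_nonneg hs (by linarith : 0 ≤ t * a' + s * a)
        (by linarith : 0 ≤ t * b' + s * b)
      -- Cramer's rule for the coefficients with respect to the two new ends.
      refine ⟨(y' * s - x' * t) / (x * y' - y * x'), (x * t - y * s) / (x * y' - y * x'),
        by positivity, by positivity, ?_⟩
      have e₁ : s = (y' * s - x' * t) / (x * y' - y * x') * x +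
          (x * t - y * s) / (x * y' - y * x') * x' := by
        rw [div_mul_eq_mul_div, div_mul_eq_mul_div, ← add_div, eq_div_iff det.ne']
        ring
      have e₂ : t = (y' * s - x' * t) / (x * y' - y * x') * y +
          (x * t - y * s) / (x * y' - y * x') * y' := by
        rw [div_mul_eq_mul_div, div_mul_eq_mul_div, ← add_div, eq_div_iff det.ne']
        ring
      linear_combination (norm := module) e₁ • P + e₂ • Q
    · rintro ⟨s, t, hs, ht, rfl⟩
      obtain ⟨hx, hy⟩ := hl.nonneg
      obtain ⟨hy', hx'⟩ := hh.nonneg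
      refine ⟨⟨s * x + t * x', s * y + t * y', by positivity, by positivity, by module⟩,
        hconv _ (hend _ hA hB el) _ (hend _ hA hB eh) s t hs ht⟩
  · rintro (rfl | rfl)
    exacts [el, eh]

end Cones

/-! ### The strip between two neighbouring normal geodesics. -/

section Strip

variable {V : Type*} [AddCommGroup V] [Module ℝ V]

/-- The ray of the point with parameter `x` on the line with the isotropic ends `n₁`, `n₂`. -/
def lineRay (n₁ n₂ : V) (x : ℝ) : V := x • n₁ + n₂

/-- The linear relation between four points, two on each line. When the factors ρ + m · are
positive, it says that the diagonals cross if v - u and v' - u' have the same sign, and that the two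
sides joining the lines cross if the signs are opposite. -/
theorem lineRay_quad (n₁ n₂ w : V) (m ρ u u' v v' : ℝ) :
    ((v' - u') * (ρ + m * v)) • lineRay n₁ n₂ u +
        ((v - u) * (ρ + m * u')) • lineRay (n₁ + m • w) (n₂ + ρ • w) v' =
      ((v - u) * (ρ + m * v')) • lineRay (n₁ + m • w) (n₂ + ρ • w) u' +
        ((v' - u') * (ρ + m * u)) • lineRay n₁ n₂ v := by
  simp only [lineRay]
  module

/-- Where the segment at v crosses a side. On the right, the weights along the side do not involve m
and ρ up to a common factor; hence the faces on both sides of it obtain the same point. -/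
theorem lineRay_crossing (n₁ n₂ w : V) (m ρ u u' v : ℝ) :
    ((v - u') * (ρ + m * u)) • lineRay n₁ n₂ v +
        ((u - v) * (ρ + m * u')) • lineRay (n₁ + m • w) (n₂ + ρ • w) v =
      (ρ + m * v) • ((v - u') • lineRay n₁ n₂ u +
        (u - v) • lineRay (n₁ + m • w) (n₂ + ρ • w) u') := by
  simp only [lineRay]
  module

theorem lineRay_crossing_abs (n₁ n₂ w : V) {m ρ u u' v : ℝ} (hm : 0 < m) (hρ : 0 < ρ)
    (hu : 0 < u) (hu' : 0 < u') (h : (v - u) * (v - u') < 0) :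
    |(v - u') * (ρ + m * u)| • lineRay n₁ n₂ v +
        |(v - u) * (ρ + m * u')| • lineRay (n₁ + m • w) (n₂ + ρ • w) v =
      (ρ + m * v) • (|v - u'| • lineRay n₁ n₂ u +
        |v - u| • lineRay (n₁ + m • w) (n₂ + ρ • w) u') := by
  have k₁ : 0 < ρ + m * u := by positivity
  have k₂ : 0 < ρ + m * u' := by positivity
  have key := lineRay_crossing n₁ n₂ w m ρ u u' v
  rw [abs_mul, abs_mul, abs_of_pos k₁, abs_of_pos k₂]
  rcases mul_neg_iff.1 h with ⟨h₁, h₂⟩ | ⟨h₁, h₂⟩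
  · rw [abs_of_pos h₁, abs_of_neg h₂]
    linear_combination (norm := module) (-1 : ℝ) • key
  · rw [abs_of_neg h₁, abs_of_pos h₂]
    linear_combination (norm := module) key

theorem lineRay_mem_between (n₁ n₂ : V) {u v w : ℝ} (h : 0 < (v - u) * (w - v)) :
    ∃ s t : ℝ, 0 ≤ s ∧ 0 ≤ t ∧ lineRay n₁ n₂ v = s • lineRay n₁ n₂ u + t • lineRay n₁ n₂ w := by
  have hne : w - u ≠ 0 := by
    intro h0
    obtain rfl : w = u := by linarith
    nlinarith [sq_nonneg (v - w)]
  refine ⟨(w - v) / (w - u), (v - u) / (w - u), ?_, ?_, ?_⟩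
  · rcases mul_pos_iff.1 h with ⟨h₁, h₂⟩ | ⟨h₁, h₂⟩
    · exact (div_pos h₂ (by linarith)).le
    · exact (div_pos_of_neg_of_neg h₂ (by linarith)).le
  · rcases mul_pos_iff.1 h with ⟨h₁, h₂⟩ | ⟨h₁, h₂⟩
    · exact (div_pos h₁ (by linarith)).le
    · exact (div_pos_of_neg_of_neg h₁ (by linarith)).le
  · have e₁ : v = (w - v) / (w - u) * u + (v - u) / (w - u) * w := by
      rw [div_mul_eq_mul_div, div_mul_eq_mul_div, ← add_div, eq_div_iff hne]; ring
    have e₂ : (1 : ℝ) = (w - v) / (w - u) + (v - u) / (w - u) := by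
      rw [← add_div, eq_div_iff hne]; ring
    simp only [lineRay]
    linear_combination (norm := module) e₁ • n₁ + e₂ • n₂

/-- The possible ends of the part of a segment in a quadrilateral of a strip, up to scaling. The
segment has parameter `v` on both lines bounding the strip, the quadrilateral has the sides with
parameters `u`, `u'` and `x`, `x'`. -/
def StripEnd (P Q : ℝ → V) (v u u' x x' : ℝ) (z : V) : Prop :=
  (0 < (v - u) * (x - v) ∧ z = P v) ∨ (0 < (v - u') * (x' - v) ∧ z = Q v) ∨
    ((v - u) * (v - u') < 0 ∧ z = |v - u'| • P u + |v - u| • Q u') ∨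
    ((v - x) * (v - x') < 0 ∧ z = |v - x'| • P x + |v - x| • Q x')

theorem StripEnd.swap {P Q : ℝ → V} {v u u' x x' : ℝ} {z : V} (h : StripEnd P Q v u u' x x' z) :
    StripEnd P Q v x x' u u' z := by
  rcases h with ⟨h, rfl⟩ | ⟨h, rfl⟩ | h | h
  · exact .inl ⟨by linarith, rfl⟩
  · exact .inr (.inl ⟨by linarith, rfl⟩)
  · exact .inr (.inr (.inr h))
  · exact .inr (.inr (.inl h))

/-- The two vectors differ by (ρ + m v) w. -/
theorem linearIndependent_lineRay {n₁ n₂ w : V} (hn : LinearIndependent ℝ ![n₁, n₂, w])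
    {m ρ v : ℝ} (h : 0 < ρ + m * v) :
    LinearIndependent ℝ ![lineRay n₁ n₂ v, lineRay (n₁ + m • w) (n₂ + ρ • w) v] := by
  rw [LinearIndependent.pair_iff]
  intro s t hst
  rw [Fintype.linearIndependent_iff] at hn
  have key := hn ![s * v + t * v, s + t, t * (ρ + m * v)] (by
    simp only [Fin.sum_univ_three, Matrix.cons_val]
    rw [← hst]
    simp only [lineRay]
    module)
  have k₁ : s + t = 0 := key 1
  have k₂ : t * (ρ + m * v) = 0 := key 2
  have ht := (mul_eq_zero.1 k₂).resolve_right h.ne'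
  exact ⟨by linarith, ht⟩

/-- The part of a segment of a strip that lies in a convex quadrilateral of the strip. -/
theorem strip_inter_eq_of_lt {n₁ n₂ w : V} (hn : LinearIndependent ℝ ![n₁, n₂, w])
    {m ρ v u u' x x' : ℝ} (hm : 0 < m) (hρ : 0 < ρ) (hv : 0 < v) (hu : 0 < u) (hu' : 0 < u')
    (hux : u < x) (hux' : u' < x') (h₁ : v ≠ u) (h₂ : v ≠ u') (h₃ : v ≠ x) (h₄ : v ≠ x')
    {P Q : ℝ → V} (hP : P = lineRay n₁ n₂) (hQ : Q = lineRay (n₁ + m • w) (n₂ + ρ • w)) :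
    ((∀ z, ¬ StripEnd P Q v u u' x x' z) ∧
        ∀ z ∈ cone2 (P v) (Q v) ∩ cone4 (P u) (Q u') (Q x') (P x), z = 0) ∨
      ∃ l h, LinearIndependent ℝ ![l, h] ∧
        cone2 (P v) (Q v) ∩ cone4 (P u) (Q u') (Q x') (P x) = cone2 l h ∧
        ∀ y, (∃ c : ℝ, 0 < c ∧ ∃ z, StripEnd P Q v u u' x x' z ∧ y = c • z) ↔
          (∃ c : ℝ, 0 < c ∧ (y = c • l ∨ y = c • h)) := by
  have hx : 0 < x := hu.trans hux
  have hx' : 0 < x' := hu'.trans hux'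
  have ku : 0 < ρ + m * u := by positivity
  have ku' : 0 < ρ + m * u' := by positivity
  have kx : 0 < ρ + m * x := by positivity
  have kx' : 0 < ρ + m * x' := by positivity
  have kv : 0 < ρ + m * v := by positivity
  have dux : 0 < x - u := sub_pos.2 hux
  have dux' : 0 < x' - u' := sub_pos.2 hux'
  -- Values at `P v` and `Q v` of the forms det(P u, Q u', ·) and -det(P x, Q x', ·) in the
  -- coordinates n₁, n₂, w. Both are nonnegative on the quadrilateral.
  set a := (v - u) * (ρ + m * u') with ha
  set a' := (v - u') * (ρ + m * u) with ha'
  set b := -((v - x) * (ρ + m * x')) with hb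
  set b' := -((v - x') * (ρ + m * x)) with hb'
  have sgn : ∀ z, StripEnd P Q v u u' x x' z → ∃ c : ℝ, 0 < c ∧
      ClipEnd (P v) (Q v) a a' b b' (c • z) := by
    rintro z (⟨h, rfl⟩ | ⟨h, rfl⟩ | ⟨h, rfl⟩ | ⟨h, rfl⟩)
    · refine ⟨1, one_pos, .inl ⟨?_, one_smul _ _⟩⟩
      have : a * b = ((v - u) * (x - v)) * ((ρ + m * u') * (ρ + m * x')) := by
        rw [ha, hb]; ring
      rw [this]; positivity
    · refine ⟨1, one_pos, .inr (.inl ⟨?_, one_smul _ _⟩)⟩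
      have : a' * b' = ((v - u') * (x' - v)) * ((ρ + m * u) * (ρ + m * x)) := by
        rw [ha', hb']; ring
      rw [this]; positivity
    · refine ⟨ρ + m * v, kv, .inr (.inr (.inl ⟨?_, ?_⟩))⟩
      · have : a * a' = ((v - u) * (v - u')) * ((ρ + m * u') * (ρ + m * u)) := by
          rw [ha, ha']; ring
        rw [this]; exact mul_neg_of_neg_of_pos h (by positivity)
      · rw [hP, hQ, ← lineRay_crossing_abs n₁ n₂ w hm hρ hu hu' h]
    · refine ⟨ρ + m * v, kv, .inr (.inr (.inr ⟨?_, ?_⟩))⟩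
      · have : b * b' = ((v - x) * (v - x')) * ((ρ + m * x') * (ρ + m * x)) := by
          rw [hb, hb']; ring
        rw [this]; exact mul_neg_of_neg_of_pos h (by positivity)
      · rw [hP, hQ, ← lineRay_crossing_abs n₁ n₂ w hm hρ hx hx' h, hb, hb', abs_neg, abs_neg]
  have sgn' : ∀ z, ClipEnd (P v) (Q v) a a' b b' z → ∃ c : ℝ, 0 < c ∧
      ∃ y, StripEnd P Q v u u' x x' y ∧ z = c • y := by
    rintro z (⟨h, rfl⟩ | ⟨h, rfl⟩ | ⟨h, rfl⟩ | ⟨h, rfl⟩)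
    · refine ⟨1, one_pos, P v, .inl ⟨?_, rfl⟩, (one_smul _ _).symm⟩
      have : a * b = ((v - u) * (x - v)) * ((ρ + m * u') * (ρ + m * x')) := by
        rw [ha, hb]; ring
      rw [this] at h; exact pos_of_mul_pos_left h (by positivity)
    · refine ⟨1, one_pos, Q v, .inr (.inl ⟨?_, rfl⟩), (one_smul _ _).symm⟩
      have : a' * b' = ((v - u') * (x' - v)) * ((ρ + m * u) * (ρ + m * x)) := by
        rw [ha', hb']; ring
      rw [this] at h; exact pos_of_mul_pos_left h (by positivity)
    · have : a * a' = ((v - u) * (v - u')) * ((ρ + m * u') * (ρ + m * u)) := by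
        rw [ha, ha']; ring
      rw [this] at h
      have h' := neg_of_mul_neg_left h (by positivity)
      refine ⟨ρ + m * v, kv, _, .inr (.inr (.inl ⟨h', rfl⟩)), ?_⟩
      rw [hP, hQ, ← lineRay_crossing_abs n₁ n₂ w hm hρ hu hu' h']
    · have : b * b' = ((v - x) * (v - x')) * ((ρ + m * x') * (ρ + m * x)) := by
        rw [hb, hb']; ring
      rw [this] at h
      have h' := neg_of_mul_neg_left h (by positivity)
      refine ⟨ρ + m * v, kv, _, .inr (.inr (.inr ⟨h', rfl⟩)), ?_⟩
      rw [hP, hQ, ← lineRay_crossing_abs n₁ n₂ w hm hρ hx hx' h', hb, hb', abs_neg, abs_neg]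
  have mem : ∀ z, StripEnd P Q v u u' x x' z → z ∈ cone4 (P u) (Q u') (Q x') (P x) := by
    rintro z (⟨h, rfl⟩ | ⟨h, rfl⟩ | ⟨h, rfl⟩ | ⟨h, rfl⟩)
    · obtain ⟨s, t, hs, ht, e⟩ := lineRay_mem_between n₁ n₂ h
      exact ⟨s, 0, 0, t, hs, le_rfl, le_rfl, ht, by rw [hP, e]; module⟩
    · obtain ⟨s, t, hs, ht, e⟩ := lineRay_mem_between (n₁ + m • w) (n₂ + ρ • w) h
      exact ⟨0, s, t, 0, le_rfl, hs, ht, le_rfl, by rw [hQ, e]; module⟩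
    · exact ⟨_, _, 0, 0, abs_nonneg _, abs_nonneg _, le_rfl, le_rfl, by module⟩
    · exact ⟨0, 0, _, _, le_rfl, le_rfl, abs_nonneg (v - x), abs_nonneg (v - x'), by module⟩
  have main := cone2_inter_eq (P := P v) (Q := Q v) (S := cone4 (P u) (Q u') (Q x') (P x)) (a := a) (a' := a') (b := b)
    (b' := b') (by rw [hP, hQ]; exact linearIndependent_lineRay hn kv)
    (mul_ne_zero (sub_ne_zero.2 h₁) ku'.ne') (mul_ne_zero (sub_ne_zero.2 h₂) ku.ne')
    (neg_ne_zero.2 (mul_ne_zero (sub_ne_zero.2 h₃) kx'.ne'))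
    (neg_ne_zero.2 (mul_ne_zero (sub_ne_zero.2 h₄) kx.ne'))
    (fun _ hx _ hy s t hs ht => cone4_convex hx hy hs ht) ?_ ?_ ?_ ?_ ?_ ?_
  · rcases main with ⟨h, h'⟩ | ⟨l, h, hlh, e, hends⟩
    · left
      refine ⟨fun z hz => ?_, h'⟩
      obtain ⟨c, _, hc⟩ := sgn z hz
      exact h _ hc
    · right
      refine ⟨l, h, hlh, e, fun y => ⟨?_, ?_⟩⟩
      · rintro ⟨c, hc, z, hz, rfl⟩
        obtain ⟨d, hd, hz'⟩ := sgn z hz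
        have hcd : c • z = (c / d) • d • z := by
          rw [smul_smul, div_mul_cancel₀ _ hd.ne']
        refine ⟨c / d, by positivity, ?_⟩
        rcases (hends _).1 hz' with h | h
        · left; rw [hcd, h]
        · right; rw [hcd, h]
      · rintro ⟨c, hc, hy⟩
        rcases hy with rfl | rfl
        · obtain ⟨d, hd, z, hz, rfl⟩ := sgn' _ ((hends l).2 (.inl rfl))
          exact ⟨c * d, by positivity, z, hz, by rw [mul_smul]⟩
        · obtain ⟨d, hd, z, hz, rfl⟩ := sgn' _ ((hends h).2 (.inr rfl))
          exact ⟨c * d, by positivity, z, hz, by rw [mul_smul]⟩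
  · rintro s t hs ht ⟨α, β, γ, δ, hα, hβ, hγ, hδ, h⟩
    rw [Fintype.linearIndependent_iff] at hn
    have key := hn ![s * v + t * v - (α * u + β * u' + γ * x' + δ * x),
      s + t - (α + β + γ + δ),
      t * (ρ + m * v) - β * (ρ + m * u') - γ * (ρ + m * x')] (by
        simp only [Fin.sum_univ_three, Matrix.cons_val]
        rw [← sub_eq_zero, hP, hQ] at h
        rw [← h]
        simp only [lineRay]
        module)
    have k₀ : s * v + t * v - (α * u + β * u' + γ * x' + δ * x) = 0 := key 0
    have k₁ : s + t - (α + β + γ + δ) = 0 := key 1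
    have k₂ : t * (ρ + m * v) - β * (ρ + m * u') - γ * (ρ + m * x') = 0 := key 2
    -- Each form vanishes at the two vertices of its own side and is positive at the other two.
    have e₁ : s * a + t * a' = γ * ((x' - u') * (ρ + m * u)) + δ * ((x - u) * (ρ + m * u')) := by
      rw [ha, ha']
      linear_combination (ρ + m * u') * (k₀ - u * k₁) + (u - u') * k₂
    have e₂ : s * b + t * b' = α * ((x - u) * (ρ + m * x')) + β * ((x' - u') * (ρ + m * x)) := by
      rw [hb, hb']
      linear_combination -(ρ + m * x') * (k₀ - x * k₁) - (x - x') * k₂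
    rw [e₁, e₂]
    constructor <;> positivity
  · intro z _ _ hz
    obtain ⟨c, hc, y, hy, rfl⟩ := sgn' z hz
    simpa using cone4_convex (mem y hy) (mem y hy) hc.le le_rfl
  -- If v < u, then v < x: `P v` cannot violate both inequalities.
  · rcases h₁.lt_or_gt with h | h
    · right; rw [hb]; nlinarith
    · left; exact mul_pos (by linarith) ku'
  · rcases h₂.lt_or_gt with h | h
    · right; rw [hb']; nlinarith
    · left; exact mul_pos (by linarith) ku
  · intro ka kb
    have k₁ : 0 < u - v := by
      by_contra hh
      exact absurd ka (not_lt.2 (mul_nonneg (by linarith) ku'.le))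
    have k₂ : 0 < v - x' := by
      by_contra hh
      rw [hb'] at kb
      nlinarith
    -- Here u' < x' < v < u < x. The two sides differ by (x' - u')(ρ + m v), those of `e₂` by (x -
    -- u)(ρ + m v); multiplying gives the order of the crossings.
    have e₁ : (v - x') * (ρ + m * u') < (v - u') * (ρ + m * x') := by
      linarith [mul_pos dux' kv]
    have e₂ : (u - v) * (ρ + m * x) < (x - v) * (ρ + m * u) := by
      linarith [mul_pos dux kv]
    have := mul_lt_mul'' e₁ e₂ (by positivity) (by positivity)
    rw [ha, ha', hb, hb']
    linarith
  · intro kb ka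
    have k₁ : 0 < u' - v := by
      by_contra hh
      exact absurd ka (not_lt.2 (mul_nonneg (by linarith) ku.le))
    have k₂ : 0 < v - x := by
      by_contra hh
      rw [hb] at kb
      nlinarith
    have e₁ : (v - x) * (ρ + m * u) < (v - u) * (ρ + m * x) := by
      linarith [mul_pos dux kv]
    have e₂ : (u' - v) * (ρ + m * x') < (x' - v) * (ρ + m * u') := by
      linarith [mul_pos dux' kv]
    have := mul_lt_mul'' e₁ e₂ (by positivity) (by positivity)
    rw [ha, ha', hb, hb']
    linarith

/-- The opposite orientation is reduced to the previous one by exchanging u, u' with x, x'. -/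
theorem strip_inter_eq {n₁ n₂ w : V} (hn : LinearIndependent ℝ ![n₁, n₂, w])
    {m ρ v u u' x x' : ℝ} (hm : 0 < m) (hρ : 0 < ρ) (hv : 0 < v) (hu : 0 < u) (hu' : 0 < u')
    (hx : 0 < x) (hx' : 0 < x') (hux : 0 < (x - u) * (x' - u'))
    (h₁ : v ≠ u) (h₂ : v ≠ u') (h₃ : v ≠ x) (h₄ : v ≠ x')
    {P Q : ℝ → V} (hP : P = lineRay n₁ n₂) (hQ : Q = lineRay (n₁ + m • w) (n₂ + ρ • w)) :
    ((∀ z, ¬ StripEnd P Q v u u' x x' z) ∧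
        ∀ z ∈ cone2 (P v) (Q v) ∩ cone4 (P u) (Q u') (Q x') (P x), z = 0) ∨
      ∃ l h, LinearIndependent ℝ ![l, h] ∧
        cone2 (P v) (Q v) ∩ cone4 (P u) (Q u') (Q x') (P x) = cone2 l h ∧
        ∀ y, (∃ c : ℝ, 0 < c ∧ ∃ z, StripEnd P Q v u u' x x' z ∧ y = c • z) ↔
          (∃ c : ℝ, 0 < c ∧ (y = c • l ∨ y = c • h)) := by
  rcases mul_pos_iff.1 hux with ⟨k, k'⟩ | ⟨k, k'⟩
  · exact strip_inter_eq_of_lt hn hm hρ hv hu hu' (by linarith) (by linarith) h₁ h₂ h₃ h₄ hP hQ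
  · have e : StripEnd P Q v u u' x x' = StripEnd P Q v x x' u u' :=
      funext fun z => propext ⟨.swap, .swap⟩
    rw [e, cone4_reverse]
    exact strip_inter_eq_of_lt hn hm hρ hv hx hx' (by linarith) (by linarith) h₃ h₄ h₁ h₂ hP hQ

end Strip

/-! ### Hyperbolic space as the rays of positive definite matrices. -/

section Hyperbolic

theorem posDef_iff_trace_det {X : M2} (hX : X.IsHermitian) :
    X.PosDef ↔ 0 < X.trace.re ∧ 0 < X.det.re := by
  constructor
  · intro h
    have h₁ := h.trace_pos
    have h₂ := h.det_pos
    exact ⟨(Complex.lt_def.1 h₁).1, (Complex.lt_def.1 h₂).1⟩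
  · rintro ⟨h₁, h₂⟩
    rw [hX.posDef_iff_eigenvalues_pos]
    rw [hX.trace_eq_sum_eigenvalues, Fin.sum_univ_two] at h₁
    rw [hX.det_eq_prod_eigenvalues, Fin.prod_univ_two] at h₂
    have k₁ : 0 < hX.eigenvalues 0 + hX.eigenvalues 1 := by simpa using h₁
    have k₂ : 0 < hX.eigenvalues 0 * hX.eigenvalues 1 := by simpa using h₂
    intro i
    rcases mul_pos_iff.1 k₂ with h | h
    · fin_cases i
      exacts [h.1, h.2]
    · linarith [h.1, h.2]

theorem mem_H3_iff {X : M2} : X ∈ H3 ↔ X.PosDef ∧ X.det = 1 := by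
  constructor
  · rintro ⟨h, h', h''⟩
    exact ⟨(posDef_iff_trace_det h).2 ⟨h', by simp [h'']⟩, h''⟩
  · rintro ⟨h, h'⟩
    exact ⟨h.isHermitian, ((posDef_iff_trace_det h.isHermitian).1 h).1, h'⟩

theorem det_real_smul (c : ℝ) (X : M2) : (c • X).det = (c : ℂ) ^ 2 * X.det := by
  have : c • X = (c : ℂ) • X := by ext i j; simp
  rw [this, det_smul, Fintype.card_fin]

theorem posDef_real_smul {X : M2} (hX : X.PosDef) {c : ℝ} (hc : 0 < c) : (c • X).PosDef :=
  hX.smul hc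

/-- The point of `H3` on the ray of a positive definite matrix. -/
noncomputable def toH3 (X : M2) : M2 := (Real.sqrt X.det.re)⁻¹ • X

theorem toH3_smul {c : ℝ} (hc : 0 < c) (X : M2) : toH3 (c • X) = toH3 X := by
  have h : (c • X).det.re = c ^ 2 * X.det.re := by
    rw [det_real_smul, ← Complex.ofReal_pow, Complex.re_ofReal_mul]
  rw [toH3, toH3, h, Real.sqrt_mul (sq_nonneg c), Real.sqrt_sq hc.le, smul_smul]
  congr 1
  field_simp

theorem exists_toH3_eq {X : M2} (hX : X.PosDef) : ∃ c : ℝ, 0 < c ∧ toH3 X = c • X :=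
  ⟨_, inv_pos.2 (Real.sqrt_pos.2 ((posDef_iff_trace_det hX.isHermitian).1 hX).2), rfl⟩

theorem toH3_mem {X : M2} (hX : X.PosDef) : toH3 X ∈ H3 := by
  have hpos := ((posDef_iff_trace_det hX.isHermitian).1 hX).2
  have him : X.det.im = 0 := ((Complex.lt_def.1 hX.det_pos).2).symm
  refine mem_H3_iff.2 ⟨posDef_real_smul hX (inv_pos.2 (Real.sqrt_pos.2 hpos)), ?_⟩
  have hdet : X.det = (X.det.re : ℂ) := Complex.ext rfl (by simp [him])
  rw [toH3, det_real_smul, ← Complex.ofReal_pow, inv_pow, Real.sq_sqrt hpos.le]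
  nth_rewrite 2 [hdet]
  rw [← Complex.ofReal_mul, inv_mul_cancel₀ hpos.ne', Complex.ofReal_one]

theorem posDef_combination {X Y : M2} (hX : X.PosDef) (hY : Y.PosDef) {s t : ℝ} (hs : 0 ≤ s)
    (ht : 0 ≤ t) (h : 0 < s ∨ 0 < t) : (s • X + t • Y).PosDef := by
  rcases hs.eq_or_lt with rfl | hs
  · rw [zero_smul, zero_add]
    exact posDef_real_smul hY (h.resolve_left (lt_irrefl _))
  rcases ht.eq_or_lt with rfl | ht
  · rw [zero_smul, add_zero]
    exact posDef_real_smul hX hs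
  exact (posDef_real_smul hX hs).add (posDef_real_smul hY ht)

theorem posDef_of_mem_cone2 {X Y Z : M2} (hX : X.PosDef) (hY : Y.PosDef) (hZ : Z ∈ cone2 X Y)
    (h0 : Z ≠ 0) : Z.PosDef := by
  obtain ⟨s, t, hs, ht, rfl⟩ := hZ
  refine posDef_combination hX hY hs ht ?_
  by_contra! h
  apply h0
  rw [le_antisymm h.1 hs, le_antisymm h.2 ht, zero_smul, zero_smul, add_zero]

theorem geoSegment_eq (x y : M2) : geoSegment x y = H3 ∩ cone2 x y := rfl

theorem geoTriangle_eq (x y z : M2) : geoTriangle x y z = H3 ∩ cone3 x y z := rfl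

theorem left_mem_geoSegment {x y : M2} (hx : x ∈ H3) : x ∈ geoSegment x y :=
  ⟨hx, 1, 0, zero_le_one, le_rfl, by module⟩

theorem right_mem_geoSegment {x y : M2} (hy : y ∈ H3) : y ∈ geoSegment x y :=
  ⟨hy, 0, 1, le_rfl, zero_le_one, by module⟩

theorem geoSegment_comm (x y : M2) : geoSegment x y = geoSegment y x := by
  rw [geoSegment_eq, geoSegment_eq, cone2_comm]

theorem zero_notMem_H3 : (0 : M2) ∉ H3 := fun h => by simpa using h.2.1

/-- For crossing diagonals both splittings give the full cone, so the intersection in `quadRegion`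
loses nothing. -/
theorem quadRegion_eq {a b c d : M2} {k₁ k₂ k₃ k₄ : ℝ} (h₁ : 0 < k₁) (h₂ : 0 < k₂)
    (h₃ : 0 < k₃) (h₄ : 0 < k₄) (h : k₁ • a + k₃ • c = k₂ • b + k₄ • d)
    {ra rb rc rd : ℝ} (ha : 0 < ra) (hb : 0 < rb) (hc : 0 < rc) (hd : 0 < rd) :
    quadRegion (ra • a) (rb • b) (rc • c) (rd • d) = H3 ∩ cone4 a b c d := by
  rw [← cone4_eq_inter h₁ h₂ h₃ h₄ h]
  simp only [quadRegion, geoTriangle_eq, cone3_smul, ha, hb, hc, hd]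
  ext z
  simp only [Set.mem_inter_iff, Set.mem_union]
  tauto

end Hyperbolic

/-! ### Frames, the ends of normal geodesics, and their change along an edge. -/

section Frame

/-- The action of a matrix, scaled by its determinant, on Hermitian matrices. -/
noncomputable def frameMap (A X : M2) : M2 := A.det⁻¹ • (A * X * Aᴴ)

theorem frameMap_add (A X Y : M2) : frameMap A (X + Y) = frameMap A X + frameMap A Y := by
  simp only [frameMap, Matrix.mul_add, Matrix.add_mul, smul_add]

theorem frameMap_smul (A : M2) (c : ℝ) (X : M2) : frameMap A (c • X) = c • frameMap A X := by
  simp only [frameMap, Matrix.mul_smul, Matrix.smul_mul]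
  rw [smul_comm]

theorem frameMap_mul (A K X : M2) :
    frameMap (A * K) X = K.det⁻¹ • frameMap A (K * X * Kᴴ) := by
  simp only [frameMap, det_mul, conjTranspose_mul, Matrix.mul_assoc, smul_smul, mul_inv]
  rw [mul_comm]

theorem frameMap_eq_zero {A X : M2} (hA : A.det ≠ 0) (h : frameMap A X = 0) : X = 0 := by
  have hu : IsUnit A.det := isUnit_iff_ne_zero.2 hA
  have hu' : IsUnit (Aᴴ).det := by
    rw [det_conjTranspose]; exact isUnit_iff_ne_zero.2 (star_ne_zero.2 hA)
  have h' : A * X * Aᴴ = 0 := (smul_eq_zero.1 h).resolve_left (inv_ne_zero hA)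
  calc X = A⁻¹ * (A * X * Aᴴ) * (Aᴴ)⁻¹ := by
        rw [Matrix.mul_assoc, Matrix.mul_assoc, Matrix.mul_assoc,
          Matrix.mul_nonsing_inv _ hu', Matrix.mul_one, Matrix.nonsing_inv_mul_cancel_left _ _ hu]
    _ = 0 := by rw [h']; simp

/-- A frame whose surface point lies in `H3` has positive determinant. -/
theorem exists_det_eq {A : M2} (h : frameMap A 1 ∈ H3) : ∃ δ : ℝ, 0 < δ ∧ A.det = δ := by
  have h1 := h.2.2
  have h2 := h.2.1
  rw [frameMap, Matrix.mul_one] at h1 h2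
  rw [det_smul, det_mul, det_conjTranspose, Fintype.card_fin] at h1
  have hne : A.det ≠ 0 := by
    intro h0
    simp [h0] at h1
  -- The determinant of the surface point is the quotient of conj(det A) by det A.
  have hstar : star A.det = A.det := by
    field_simp at h1
    exact h1
  have hre : A.det = (A.det.re : ℂ) := (Complex.conj_eq_iff_re.1 hstar).symm
  refine ⟨A.det.re, ?_, hre⟩
  rw [hre, trace_smul, smul_eq_mul, ← Complex.ofReal_inv, Complex.re_ofReal_mul] at h2
  have h3 : 0 ≤ (A * Aᴴ).trace.re :=
    (Complex.le_def.1 (posSemidef_self_mul_conjTranspose A).trace_nonneg).1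
  exact inv_pos.1 (pos_of_mul_pos_left h2 h3)

theorem frameMap_posDef {A X : M2} {δ : ℝ} (hδ : 0 < δ) (hA : A.det = δ) (hX : X.PosDef) :
    (frameMap A X).PosDef := by
  have hu : IsUnit A := (isUnit_iff_isUnit_det A).2 (by
    rw [hA]; exact isUnit_iff_ne_zero.2 (by exact_mod_cast hδ.ne'))
  have e : frameMap A X = δ⁻¹ • (A * X * Aᴴ) := by
    rw [frameMap, hA]; ext i j; simp
  rw [e]
  refine posDef_real_smul ?_ (inv_pos.2 hδ)
  exact hX.mul_mul_conjTranspose_same (vecMul_injective_of_isUnit hu)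

theorem frameMap_det {A X : M2} {δ : ℝ} (hδ : 0 < δ) (hA : A.det = δ) :
    (frameMap A X).det = X.det := by
  have h0 : (δ : ℂ) ≠ 0 := by exact_mod_cast hδ.ne'
  have hs : star (δ : ℂ) = δ := Complex.conj_ofReal δ
  rw [frameMap, det_smul, det_mul, det_mul, det_conjTranspose, hA, hs, Fintype.card_fin]
  field_simp

/-- The isotropic vector at the positive end of the normal geodesic. -/
noncomputable def posEnd (A : M2) : M2 := frameMap A !![1, 0; 0, 0]

/-- The isotropic vector at the negative end of the normal geodesic. -/
noncomputable def negEnd (A : M2) : M2 := frameMap A !![0, 0; 0, 1]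

theorem lineRay_ends (A : M2) (u : ℝ) :
    lineRay (posEnd A) (negEnd A) u = frameMap A !![(u : ℂ), 0; 0, 1] := by
  rw [lineRay, posEnd, negEnd, ← frameMap_smul, ← frameMap_add]
  congr 1
  ext i j
  fin_cases i <;> fin_cases j <;> simp

theorem posDef_diag {u : ℝ} (hu : 0 < u) : (!![(u : ℂ), 0; 0, 1] : M2).PosDef := by
  have : (!![(u : ℂ), 0; 0, 1] : M2) = diagonal ![(u : ℂ), 1] := by
    ext i j
    fin_cases i <;> fin_cases j <;> simp
  rw [this, posDef_diagonal_iff]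
  intro i
  fin_cases i
  · simpa using hu
  · simp

theorem frameMap_one (E : Lattice → M2) (p : Lattice) : surface E p = frameMap (E p) 1 := by
  rw [surface, frameMap, Matrix.mul_one]

theorem surface_eq (E : Lattice → M2) (p : Lattice) :
    surface E p = posEnd (E p) + negEnd (E p) := by
  rw [frameMap_one, posEnd, negEnd, ← frameMap_add]
  congr 1
  ext i j
  fin_cases i <;> fin_cases j <;> simp

theorem normal_eq (E : Lattice → M2) (p : Lattice) :
    normal E p = posEnd (E p) - negEnd (E p) := by
  have : posEnd (E p) = normal E p + negEnd (E p) := by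
    change _ = frameMap (E p) _ + _
    rw [posEnd, negEnd, ← frameMap_add]
    congr 1
    ext i j
    fin_cases i <;> fin_cases j <;> simp
  rw [this, add_sub_cancel_right]

/-- The surface point is n₁ + n₂ and the normal n₁ - n₂, so the point at t is e^t n₁ + e^{-t} n₂. -/
theorem geodesic_eq (E : Lattice → M2) (p : Lattice) (t : ℝ) :
    Real.cosh t • surface E p + Real.sinh t • normal E p =
      Real.exp (-t) • lineRay (posEnd (E p)) (negEnd (E p)) (Real.exp (2 * t)) := by
  have h : Real.exp t = Real.exp (-t) * Real.exp (2 * t) := by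
    rw [← Real.exp_add]; ring_nf
  rw [surface_eq, normal_eq, lineRay, Real.cosh_eq, Real.sinh_eq]
  linear_combination (norm := module) h • posEnd (E p)

theorem geodesic_mem_H3 {E : Lattice → M2} {p : Lattice} (h : surface E p ∈ H3) (t : ℝ) :
    Real.cosh t • surface E p + Real.sinh t • normal E p ∈ H3 := by
  rw [frameMap_one] at h
  obtain ⟨δ, hδ, hA⟩ := exists_det_eq h
  rw [geodesic_eq, lineRay_ends]
  refine mem_H3_iff.2 ⟨posDef_real_smul (frameMap_posDef hδ hA (posDef_diag (Real.exp_pos _)))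
    (Real.exp_pos _), ?_⟩
  rw [det_real_smul, frameMap_det hδ hA, det_fin_two_of]
  rw [mul_one, mul_zero, sub_zero, ← Complex.ofReal_pow, ← Complex.ofReal_mul, ← Real.exp_nat_mul,
    ← Real.exp_add]
  simp

/-- The transition between the frames at the ends of an edge. -/
theorem ends_of_edge {A B : M2} {Δ : ℂ} {m : ℝ} (hΔ : Δ ≠ 0)
    (hA : frameMap A 1 ∈ H3) (hB : frameMap B 1 ∈ H3)
    (h : B - A = A * !![0, Δ; (m : ℂ) / Δ, 0]) :
    ∃ (w : M2) (ρ : ℝ), 0 < ρ ∧ LinearIndependent ℝ ![posEnd A, negEnd A, w] ∧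
      posEnd B = posEnd A + m • w ∧ negEnd B = negEnd A + ρ • w := by
  obtain ⟨δ, hδ, hdA⟩ := exists_det_eq hA
  obtain ⟨δ', hδ', hdB⟩ := exists_det_eq hB
  have hB' : B = A * !![1, Δ; (m : ℂ) / Δ, 1] := by
    have : (!![1, Δ; (m : ℂ) / Δ, 1] : M2) = 1 + !![0, Δ; (m : ℂ) / Δ, 0] := by
      ext i j
      fin_cases i <;> fin_cases j <;> simp
    rw [this, Matrix.mul_add, Matrix.mul_one, ← h, add_sub_cancel]
  have hdet : (!![1, Δ; (m : ℂ) / Δ, 1] : M2).det = 1 - (m : ℂ) := by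
    rw [det_fin_two_of]; field_simp
  have hm : (1 - m : ℝ) ≠ 0 := by
    intro h0
    have h0' : (1 - (m : ℂ)) = 0 := by exact_mod_cast h0
    rw [hB', det_mul, hdet, h0', mul_zero] at hdB
    exact hδ'.ne (by exact_mod_cast hdB)
  have hmC : (1 - (m : ℂ)) ≠ 0 := by exact_mod_cast hm
  have hΔ' : (starRingEnd ℂ) Δ ≠ 0 := (map_ne_zero _).2 hΔ
  have hρ : ((‖Δ‖ ^ 2 : ℝ) : ℂ) = Δ * (starRingEnd ℂ) Δ := by
    rw [Complex.mul_conj, Complex.normSq_eq_norm_sq]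
  -- The transition matrix changes diag(1, 0) by m W/(1 - m) and diag(0, 1) by |Δ|² W/(1 - m). The
  -- off-diagonal entries of W do not vanish, which gives the independence.
  set W : M2 := !![1, 1 / (starRingEnd ℂ) Δ; 1 / Δ, (m : ℂ) / (Δ * (starRingEnd ℂ) Δ)] with hW
  have hsmul : ∀ Y : M2, (1 - (m : ℂ))⁻¹ • Y = (1 - m)⁻¹ • Y := fun Y => by
    ext i j
    simp
  have hT : (!![1, Δ; (m : ℂ) / Δ, 1] : M2)ᴴ =
      !![1, (m : ℂ) / (starRingEnd ℂ) Δ; (starRingEnd ℂ) Δ, 1] := by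
    ext i j
    fin_cases i <;> fin_cases j <;> simp
  have e₁ : (1 - m)⁻¹ • (!![1, Δ; (m : ℂ) / Δ, 1] * !![1, 0; 0, 0] *
      (!![1, Δ; (m : ℂ) / Δ, 1])ᴴ : M2) = !![1, 0; 0, 0] + m • (1 - m)⁻¹ • W := by
    rw [← hsmul, ← hsmul, hT, Matrix.mul_fin_two, Matrix.mul_fin_two]
    ext i j
    fin_cases i <;> fin_cases j <;> simp [hW] <;> (field_simp; try ring)
  have e₂ : (1 - m)⁻¹ • (!![1, Δ; (m : ℂ) / Δ, 1] * !![0, 0; 0, 1] *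
      (!![1, Δ; (m : ℂ) / Δ, 1])ᴴ : M2) =
      !![0, 0; 0, 1] + (‖Δ‖ ^ 2 : ℝ) • (1 - m)⁻¹ • W := by
    rw [← hsmul, ← hsmul, hT, Matrix.mul_fin_two, Matrix.mul_fin_two]
    have : ∀ Y : M2, (‖Δ‖ ^ 2 : ℝ) • Y = (Δ * (starRingEnd ℂ) Δ) • Y := fun Y => by
      rw [← hρ]; ext i j; simp
    rw [this]
    ext i j
    fin_cases i <;> fin_cases j <;> simp [hW] <;> (field_simp; try ring)
  refine ⟨frameMap A ((1 - m)⁻¹ • W), ‖Δ‖ ^ 2, by positivity, ?_, ?_, ?_⟩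
  · rw [Fintype.linearIndependent_iff]
    intro c hc
    simp only [Fin.sum_univ_three, Matrix.cons_val, posEnd, negEnd] at hc
    rw [← frameMap_smul, ← frameMap_smul, ← frameMap_smul, ← frameMap_add, ← frameMap_add] at hc
    have h0 := frameMap_eq_zero (by rw [hdA]; exact_mod_cast hδ.ne') hc
    rw [← hsmul] at h0
    have h10 := congrFun (congrFun h0 1) 0
    have h00 := congrFun (congrFun h0 0) 0
    have h11 := congrFun (congrFun h0 1) 1
    have c2 : c 2 = 0 := by simpa [hW, hΔ, hmC] using h10
    have c0 : c 0 = 0 := by simpa [hW, c2] using h00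
    have c1 : c 1 = 0 := by simpa [hW, c2] using h11
    intro i
    fin_cases i
    exacts [c0, c1, c2]
  · rw [posEnd, hB', frameMap_mul, hdet, hsmul, ← frameMap_smul, e₁, frameMap_add, frameMap_smul,
      posEnd]
  · rw [negEnd, hB', frameMap_mul, hdet, hsmul, ← frameMap_smul, e₂, frameMap_add, frameMap_smul,
      negEnd]

end Frame

/-! ### Parameters of the parallel surface and of the caustic vertices. -/

section Caustic

/-- The ray of the point with parameter `x` on the normal geodesic at `p`. -/
noncomputable def normalRay (E : Lattice → M2) (p : Lattice) : ℝ → M2 :=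
  lineRay (posEnd (E p)) (negEnd (E p))

theorem normalRay_posDef {E : Lattice → M2} {p : Lattice} (h : surface E p ∈ H3) {u : ℝ}
    (hu : 0 < u) : (normalRay E p u).PosDef := by
  rw [frameMap_one] at h
  obtain ⟨δ, hδ, hA⟩ := exists_det_eq h
  rw [normalRay, lineRay_ends]
  exact frameMap_posDef hδ hA (posDef_diag hu)

theorem parallel_eq_geodesic (E : Lattice → M2) (d : ℝ) (p : Lattice) :
    parallel E d p = Real.cosh (-Real.log d) • surface E p +
      Real.sinh (-Real.log d) • normal E p := by
  rw [parallel, Real.cosh_neg, Real.sinh_neg, neg_smul, sub_eq_add_neg]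

theorem parallel_eq (E : Lattice → M2) {d : ℝ} (hd : 0 < d) (p : Lattice) :
    parallel E d p = d • normalRay E p (d ^ 2)⁻¹ := by
  have h : Real.exp (2 * -Real.log d) = (d ^ 2)⁻¹ := by
    rw [mul_neg, Real.exp_neg, two_mul, Real.exp_add, Real.exp_log hd, sq]
  rw [parallel_eq_geodesic, geodesic_eq, neg_neg, Real.exp_log hd, h, normalRay]

/-- As `caustic` is a choice, a common point is first exhibited, at x = -ρ/m. Independence of the
ends and w then forces equal parameters on both geodesics. -/
theorem caustic_eq {E : Lattice → M2} {p : Lattice} (hp : surface E p ∈ H3) {w : M2} {m ρ : ℝ}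
    (hm : m < 0) (hρ : 0 < ρ)
    (hw : LinearIndependent ℝ ![posEnd (E p), negEnd (E p), w])
    (h₁ : posEnd (E (p + e₂)) = posEnd (E p) + m • w)
    (h₂ : negEnd (E (p + e₂)) = negEnd (E p) + ρ • w) :
    ∃ u : ℝ, 0 < u ∧ normalRay E p u = normalRay E (p + e₂) u ∧ caustic E p ∈ H3 ∧
      ∃ c : ℝ, 0 < c ∧ caustic E p = c • normalRay E p u := by
  have hex : ∃ z, z ∈ normalGeodesic E p ∩ normalGeodesic E (p + e₂) := by
    have hk : 0 < -ρ / m := div_pos_of_neg_of_neg (by linarith) hm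
    have hexp : Real.exp (2 * (Real.log (-ρ / m) / 2)) = -ρ / m := by
      rw [mul_div_cancel₀ _ two_ne_zero, Real.exp_log hk]
    refine ⟨_, ⟨Real.log (-ρ / m) / 2, rfl⟩, ⟨Real.log (-ρ / m) / 2, ?_⟩⟩
    rw [geodesic_eq, geodesic_eq, hexp, h₁, h₂]
    congr 1
    have : -ρ / m * m + ρ = 0 := by field_simp [hm.ne]; ring
    simp only [lineRay]
    linear_combination (norm := module) -this • w
  obtain ⟨⟨t, ht⟩, ⟨s, hs⟩⟩ := Classical.epsilon_spec hex
  change caustic E p = _ at ht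
  change caustic E p = _ at hs
  have hH := geodesic_mem_H3 hp t
  rw [← ht] at hH
  rw [geodesic_eq] at ht hs
  have e : ∀ r : ℝ, Real.exp (-r) * Real.exp (2 * r) = Real.exp r := fun r => by
    rw [← Real.exp_add]; ring_nf
  have hts := ht.symm.trans hs
  rw [lineRay, lineRay, smul_add, smul_add, smul_smul, smul_smul, e, e, h₁, h₂] at hts
  rw [Fintype.linearIndependent_iff] at hw
  have key := hw ![Real.exp t - Real.exp s, Real.exp (-t) - Real.exp (-s),
    -(Real.exp s * m + Real.exp (-s) * ρ)] (by
      simp only [Fin.sum_univ_three, Matrix.cons_val]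
      linear_combination (norm := module) hts)
  have k₀ : Real.exp t - Real.exp s = 0 := key 0
  have k₂ : -(Real.exp s * m + Real.exp (-s) * ρ) = 0 := key 2
  obtain rfl : t = s := Real.exp_injective (sub_eq_zero.1 k₀)
  refine ⟨Real.exp (2 * t), Real.exp_pos _, ?_, hH, Real.exp (-t), Real.exp_pos _, ht⟩
  have k : Real.exp (2 * t) * m + ρ = 0 := by
    have hne := (Real.exp_pos (-t)).ne'
    refine (mul_eq_zero.1 (?_ : Real.exp (-t) * _ = 0)).resolve_left hne
    linear_combination -k₂ + m * e t
  simp only [normalRay, lineRay, h₁, h₂]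
  linear_combination (norm := module) -k • w

end Caustic

/-! ### Faces of the caustic, their ends, and the graph. -/

section Faces

/-- Data of a discrete flat surface relevant to its caustic and its parallel surface: `κ p` is the
parameter of the caustic vertex at the vertical edge from `p` to `p + e₂`, on both normal
geodesics, and `v` is the parameter of the parallel surface on all normal geodesics. -/
structure CausticData (D : Set Lattice) (E : Lattice → M2) (d : ℝ) (κ : Lattice → ℝ) (v : ℝ) :
    Prop where
  surface_mem : ∀ p ∈ D, surface E p ∈ H3
  v_pos : 0 < v
  parallel : ∃ c : ℝ, 0 < c ∧ ∀ p, DiscreteFlat.parallel E d p = c • normalRay E p v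
  horizontal : ∀ p, p ∈ D → p + e₁ ∈ D → ∃ (w : M2) (m ρ : ℝ), 0 < m ∧ 0 < ρ ∧
    LinearIndependent ℝ ![posEnd (E p), negEnd (E p), w] ∧
    normalRay E (p + e₁) = lineRay (posEnd (E p) + m • w) (negEnd (E p) + ρ • w)
  pos : ∀ p, p ∈ D → p + e₂ ∈ D → 0 < κ p
  ne : ∀ p, p ∈ D → p + e₂ ∈ D → v ≠ κ p
  ray_eq : ∀ p, p ∈ D → p + e₂ ∈ D → normalRay E p (κ p) = normalRay E (p + e₂) (κ p)
  caustic_mem : ∀ p, p ∈ D → p + e₂ ∈ D → caustic E p ∈ H3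
  caustic : ∀ p, p ∈ D → p + e₂ ∈ D → ∃ c : ℝ, 0 < c ∧
    DiscreteFlat.caustic E p = c • normalRay E p (κ p)

theorem exists_causticData {D : Set Lattice} {g : Lattice → ℂ} {α : Sym2 Lattice → ℝ} {lam : ℝ}
    {E : Lattice → M2}
    (hg : ∀ p ∈ D, ∀ q ∈ D, IsStep p q → g q - g p ≠ 0)
    (hhor : ∀ p, p ∈ D → p + e₁ ∈ D → 0 < lam * α s(p, p + e₁))
    (hver : ∀ p, p ∈ D → p + e₂ ∈ D → lam * α s(p, p + e₂) < 0)
    (hE : IsLift D g α lam E) (hH3 : ∀ p ∈ D, surface E p ∈ H3) {d : ℝ} (hd : 0 < d)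
    (hadj : ∀ p ∈ D, ∀ q ∈ D, IsStep p q → parallel E d p ≠ parallel E d q) :
    ∃ κ v, CausticData D E d κ v := by
  have edge : ∀ p ∈ D, ∀ q ∈ D, IsStep p q → ∃ (w : M2) (ρ : ℝ), 0 < ρ ∧
      LinearIndependent ℝ ![posEnd (E p), negEnd (E p), w] ∧
      posEnd (E q) = posEnd (E p) + (lam * α s(p, q)) • w ∧
      negEnd (E q) = negEnd (E p) + ρ • w := fun p hp q hq h =>
    ends_of_edge (hg p hp q hq h) (by rw [← frameMap_one]; exact hH3 p hp)
      (by rw [← frameMap_one]; exact hH3 q hq) (hE p hp q hq h)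
  have hκ : ∀ p, ∃ u : ℝ, p ∈ D → p + e₂ ∈ D →
      0 < u ∧ normalRay E p u = normalRay E (p + e₂) u ∧ caustic E p ∈ H3 ∧
        ∃ c : ℝ, 0 < c ∧ caustic E p = c • normalRay E p u := by
    intro p
    by_cases h : p ∈ D ∧ p + e₂ ∈ D
    · obtain ⟨w, ρ, hρ, hw, h₁, h₂⟩ := edge p h.1 _ h.2 (.inr rfl)
      obtain ⟨u, hu⟩ := caustic_eq (hH3 p h.1) (hver p h.1 h.2) hρ hw h₁ h₂
      exact ⟨u, fun _ _ => hu⟩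
    -- A dummy value where there is no vertical edge.
    · exact ⟨0, fun h₁ h₂ => absurd ⟨h₁, h₂⟩ h⟩
  choose κ hκ using hκ
  refine ⟨κ, (d ^ 2)⁻¹, hH3, by positivity, ⟨d, hd, parallel_eq E hd⟩, ?_,
    fun p h h' => (hκ p h h').1, ?_, fun p h h' => (hκ p h h').2.1,
    fun p h h' => (hκ p h h').2.2.1, fun p h h' => (hκ p h h').2.2.2⟩
  · intro p h h'
    obtain ⟨w, ρ, hρ, hw, h₁, h₂⟩ := edge p h _ h' (.inl rfl)
    exact ⟨w, _, ρ, hhor p h h', hρ, hw, by rw [normalRay, h₁, h₂]⟩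
  -- If v were the caustic parameter, both vertices of f^d would lie at the caustic vertex.
  · intro p h h' hv
    refine hadj p h _ h' (.inr rfl) ?_
    rw [parallel_eq E hd, parallel_eq E hd, hv, (hκ p h h').2.1]

/-- The ends of the part of the edge of the parallel surface in the face of the caustic. -/
def FaceEnd (E : Lattice → M2) (κ : Lattice → ℝ) (v : ℝ) (p : Lattice) (z : M2) : Prop :=
  ∃ y, StripEnd (normalRay E p) (normalRay E (p + e₁)) v (κ (p - e₂)) (κ (p + e₁ - e₂)) (κ p)
    (κ (p + e₁)) y ∧ z = toH3 y

variable {D : Set Lattice} {E : Lattice → M2} {d : ℝ} {κ : Lattice → ℝ} {v : ℝ}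

theorem not_embedded_of_common {a b c d x : M2} {ra rb rc rd : ℝ} (ha : 0 < ra) (hb : 0 < rb)
    (hc : 0 < rc) (hd : 0 < rd) (hx : x.PosDef) (h₁ : x ∈ cone2 a b) (h₂ : x ∈ cone2 c d) :
    ¬ EmbeddedQuad geoSegment (ra • a) (rb • b) (rc • c) (rd • d) := by
  intro h
  obtain ⟨r, hr, hrx⟩ := exists_toH3_eq hx
  have hH := toH3_mem hx
  have hmem : toH3 x ∈ (∅ : Set M2) := by
    rw [← h.1, geoSegment_eq, geoSegment_eq, cone2_smul ha hb, cone2_smul hc hd]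
    refine ⟨⟨hH, ?_⟩, hH, ?_⟩
    · obtain ⟨s, t, hs, ht, rfl⟩ := h₁
      exact ⟨r * s, r * t, by positivity, by positivity, by rw [hrx]; module⟩
    · obtain ⟨s, t, hs, ht, rfl⟩ := h₂
      exact ⟨r * s, r * t, by positivity, by positivity, by rw [hrx]; module⟩
  exact hmem

/-- In an embedded face the two sides on the normal geodesics have the same direction. -/
theorem same_direction_of_embedded {n₁ n₂ w : M2} {m ρ u u' x x' : ℝ} (hm : 0 < m) (hρ : 0 < ρ)
    (hu : 0 < u) (hu' : 0 < u') (hx : 0 < x) (hx' : 0 < x')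
    {P Q : ℝ → M2} (hP : P = lineRay n₁ n₂) (hQ : Q = lineRay (n₁ + m • w) (n₂ + ρ • w))
    (hPpos : ∀ u, 0 < u → (P u).PosDef) (hQpos : ∀ u, 0 < u → (Q u).PosDef)
    {ra rb rc rd : ℝ} (ha : 0 < ra) (hb : 0 < rb) (hc : 0 < rc) (hd : 0 < rd)
    (h : EmbeddedQuad geoSegment (ra • P u) (rb • Q u') (rc • Q x') (rd • P x)) :
    0 < (x - u) * (x' - u') := by
  by_contra! hle
  have ku : 0 < ρ + m * u := by positivity
  have ku' : 0 < ρ + m * u' := by positivity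
  have kx : 0 < ρ + m * x := by positivity
  have kx' : 0 < ρ + m * x' := by positivity
  -- With opposite directions this relation exhibits a common point of the two sides joining the
  -- geodesics; a degenerate direction gives them a common vertex.
  have quad := lineRay_quad n₁ n₂ w m ρ u u' x x'
  rw [← hP, ← hQ] at quad
  rcases eq_or_ne x u with rfl | hxu
  · exact not_embedded_of_common ha hb hc hd (hPpos _ hx)
      ⟨1, 0, zero_le_one, le_rfl, by module⟩ ⟨0, 1, le_rfl, zero_le_one, by module⟩ h
  rcases eq_or_ne x' u' with rfl | hxu'
  · exact not_embedded_of_common ha hb hc hd (hQpos _ hx')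
      ⟨0, 1, le_rfl, zero_le_one, by module⟩ ⟨1, 0, zero_le_one, le_rfl, by module⟩ h
  have hlt : (x - u) * (x' - u') < 0 :=
    lt_of_le_of_ne hle (mul_ne_zero (sub_ne_zero.2 hxu) (sub_ne_zero.2 hxu'))
  rcases mul_neg_iff.1 hlt with ⟨k, k'⟩ | ⟨k, k'⟩
  · have l : 0 < u' - x' := by linarith
    refine not_embedded_of_common ha hb hc hd
      (posDef_combination (hPpos u hu) (hQpos u' hu') (mul_pos l kx).le (mul_pos k kx').le
        (.inl (mul_pos l kx)))
      ⟨_, _, (mul_pos l kx).le, (mul_pos k kx').le, rfl⟩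
      ⟨_, _, (mul_pos k ku').le, (mul_pos l ku).le, ?_⟩ h
    linear_combination (norm := module) (-1 : ℝ) • quad
  · have l : 0 < u - x := by linarith
    refine not_embedded_of_common ha hb hc hd
      (posDef_combination (hPpos u hu) (hQpos u' hu') (mul_pos k' kx).le (mul_pos l kx').le
        (.inl (mul_pos k' kx)))
      ⟨_, _, (mul_pos k' kx).le, (mul_pos l kx').le, rfl⟩
      ⟨_, _, (mul_pos l ku').le, (mul_pos k' ku).le, ?_⟩ h
    linear_combination (norm := module) quad

theorem quadRegion_strip {n₁ n₂ w : M2} {m ρ u u' x x' : ℝ} (hm : 0 < m) (hρ : 0 < ρ)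
    (hu : 0 < u) (hu' : 0 < u') (hx : 0 < x) (hx' : 0 < x') (h : 0 < (x - u) * (x' - u'))
    {P Q : ℝ → M2} (hP : P = lineRay n₁ n₂) (hQ : Q = lineRay (n₁ + m • w) (n₂ + ρ • w))
    {ra rb rc rd : ℝ} (ha : 0 < ra) (hb : 0 < rb) (hc : 0 < rc) (hd : 0 < rd) :
    quadRegion (ra • P u) (rb • Q u') (rc • Q x') (rd • P x) =
      H3 ∩ cone4 (P u) (Q u') (Q x') (P x) := by
  have ku : 0 < ρ + m * u := by positivity
  have ku' : 0 < ρ + m * u' := by positivity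
  have kx : 0 < ρ + m * x := by positivity
  have kx' : 0 < ρ + m * x' := by positivity
  have quad := lineRay_quad n₁ n₂ w m ρ u u' x x'
  rw [← hP, ← hQ] at quad
  rcases mul_pos_iff.1 h with ⟨k, k'⟩ | ⟨k, k'⟩
  · exact quadRegion_eq (mul_pos k' kx) (mul_pos k kx') (mul_pos k ku') (mul_pos k' ku) quad
      ha hb hc hd
  · have l : 0 < u - x := by linarith
    have l' : 0 < u' - x' := by linarith
    refine quadRegion_eq (mul_pos l' kx) (mul_pos l kx') (mul_pos l ku') (mul_pos l' ku) ?_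
      ha hb hc hd
    linear_combination (norm := module) (-1 : ℝ) • quad

theorem toH3_ne {l h : M2} (hl : l.PosDef) (hh : h.PosDef)
    (hlh : LinearIndependent ℝ ![l, h]) : toH3 l ≠ toH3 h := by
  intro e
  obtain ⟨c, hc, hc'⟩ := exists_toH3_eq hl
  obtain ⟨b, _, hb'⟩ := exists_toH3_eq hh
  rw [hc', hb', ← sub_eq_zero] at e
  rw [LinearIndependent.pair_iff] at hlh
  exact hc.ne' (hlh c (-b) (by rw [← e]; module)).1

/-- The strip result transferred to `H3`: the generators of the clipped cone are positive definite,
and their normalizations are the ends, distinct by linear independence. -/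
theorem singularPart_eq (hC : CausticData D E d κ v) {p : Lattice} (hf : HasFace D p)
    (hemb : FaceEmbedded E p) :
    (singularPart D E d p = ∅ ∧ ∀ z, ¬ FaceEnd E κ v p z) ∨
      ∃ x y, x ∈ H3 ∧ y ∈ H3 ∧ x ≠ y ∧ singularPart D E d p = geoSegment x y ∧
        ∀ z, FaceEnd E κ v p z ↔ z = x ∨ z = y := by
  have hf' := hf
  obtain ⟨h₁, h₂, h₃, h₄, h₅, h₆⟩ := hf
  have h₁' : p - e₂ + e₂ ∈ D := by rwa [sub_add_cancel]
  have h₄' : p + e₁ - e₂ + e₂ ∈ D := by rwa [sub_add_cancel]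
  obtain ⟨w, m, ρ, hm, hρ, hw, hQ⟩ := hC.horizontal p h₂ h₅
  obtain ⟨ra, ha, hca⟩ := hC.caustic _ h₁ h₁'
  obtain ⟨rb, hb, hcb⟩ := hC.caustic _ h₄ h₄'
  obtain ⟨rc, hc, hcc⟩ := hC.caustic _ h₅ h₆
  obtain ⟨rd, hd, hcd⟩ := hC.caustic _ h₂ h₃
  rw [hC.ray_eq _ h₁ h₁', sub_add_cancel] at hca
  rw [hC.ray_eq _ h₄ h₄', sub_add_cancel] at hcb
  have hu := hC.pos _ h₁ h₁'
  have hu' := hC.pos _ h₄ h₄'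
  have hx' := hC.pos _ h₅ h₆
  have hx := hC.pos _ h₂ h₃
  have hP : normalRay E p = lineRay (posEnd (E p)) (negEnd (E p)) := rfl
  have hPpos : ∀ u, 0 < u → (normalRay E p u).PosDef := fun u hu =>
    normalRay_posDef (hC.surface_mem p h₂) hu
  have hQpos : ∀ u, 0 < u → (normalRay E (p + e₁) u).PosDef := fun u hu =>
    normalRay_posDef (hC.surface_mem _ h₅) hu
  rw [FaceEmbedded, hca, hcb, hcc, hcd] at hemb
  have hdir := same_direction_of_embedded hm hρ hu hu' hx hx' hP hQ hPpos hQpos ha hb hc hd hemb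
  obtain ⟨r, hr, hpar⟩ := hC.parallel
  have hpart : singularPart D E d p = H3 ∩ (cone2 (normalRay E p v) (normalRay E (p + e₁) v) ∩
      cone4 (normalRay E p (κ (p - e₂))) (normalRay E (p + e₁) (κ (p + e₁ - e₂)))
        (normalRay E (p + e₁) (κ (p + e₁))) (normalRay E p (κ p))) := by
    have hreg := quadRegion_strip hm hρ hu hu' hx hx' hdir hP hQ ha hb hc hd
    ext z
    simp only [singularPart, face, hca, hcb, hcc, hcd, hreg, hpar, geoSegment_eq,
      cone2_smul hr hr, Set.mem_ofPred_eq, Set.mem_inter_iff, hf', true_and]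
    tauto
  have hempty : ∀ z, z ∈ H3 → z ≠ 0 := fun z hz h0 => zero_notMem_H3 (h0 ▸ hz)
  rcases strip_inter_eq hw hm hρ hC.v_pos hu hu' hx hx' hdir (hC.ne _ h₁ h₁') (hC.ne _ h₄ h₄')
    (hC.ne _ h₂ h₃) (hC.ne _ h₅ h₆) hP hQ with ⟨hno, hzero⟩ | ⟨l, h, hlh, hcone, hends⟩
  · left
    constructor
    · rw [hpart, Set.eq_empty_iff_forall_notMem]
      rintro z ⟨hz, hz'⟩
      exact hempty z hz (hzero z hz')
    · rintro z ⟨y, hy, _⟩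
      exact hno y hy
  · right
    have hpos : ∀ y, y ∈ cone2 l h → y ≠ 0 → y.PosDef := by
      intro y hy h0
      rw [← hcone] at hy
      exact posDef_of_mem_cone2 (hPpos v hC.v_pos) (hQpos v hC.v_pos) hy.1 h0
    have hl : l.PosDef := hpos l ⟨1, 0, zero_le_one, le_rfl, by module⟩ (hlh.ne_zero 0)
    have hh : h.PosDef := hpos h ⟨0, 1, le_rfl, zero_le_one, by module⟩ (hlh.ne_zero 1)
    obtain ⟨c, hc, hc'⟩ := exists_toH3_eq hl
    obtain ⟨b, hb, hb'⟩ := exists_toH3_eq hh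
    refine ⟨toH3 l, toH3 h, toH3_mem hl, toH3_mem hh, toH3_ne hl hh hlh, ?_, fun z => ⟨?_, ?_⟩⟩
    · rw [hpart, hcone, geoSegment_eq, hc', hb', cone2_smul hc hb]
    · rintro ⟨y, hy, rfl⟩
      obtain ⟨c, hc, e | e⟩ := (hends y).1 ⟨1, one_pos, y, hy, (one_smul _ _).symm⟩
      · left; rw [e, toH3_smul hc]
      · right; rw [e, toH3_smul hc]
    · rintro (rfl | rfl)
      · obtain ⟨c, hc, y, hy, e⟩ := (hends l).2 ⟨1, one_pos, .inl (one_smul _ _).symm⟩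
        exact ⟨y, hy, by rw [e, toH3_smul hc]⟩
      · obtain ⟨c, hc, y, hy, e⟩ := (hends h).2 ⟨1, one_pos, .inr (one_smul _ _).symm⟩
        exact ⟨y, hy, by rw [e, toH3_smul hc]⟩

theorem mem_geoSegment_of_cone {a b x : M2} {ra rb s t : ℝ} (ha : 0 < ra) (hb : 0 < rb)
    (hs : 0 ≤ s) (ht : 0 ≤ t) (hx : x.PosDef) (h : x = s • a + t • b) :
    toH3 x ∈ geoSegment (ra • a) (rb • b) := by
  rw [geoSegment_eq, cone2_smul ha hb]
  obtain ⟨r, hr, hrx⟩ := exists_toH3_eq hx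
  exact ⟨toH3_mem hx, r * s, r * t, by positivity, by positivity, by rw [hrx, h]; module⟩

theorem lineRay_between_mem {n₁ n₂ : M2} {u v w ra rb : ℝ} (ha : 0 < ra) (hb : 0 < rb)
    (hv : (lineRay n₁ n₂ v).PosDef) (h : 0 < (v - u) * (w - v)) :
    toH3 (lineRay n₁ n₂ v) ∈ geoSegment (ra • lineRay n₁ n₂ u) (rb • lineRay n₁ n₂ w) := by
  obtain ⟨s, t, hs, ht, e⟩ := lineRay_mem_between n₁ n₂ h
  exact mem_geoSegment_of_cone ha hb hs ht hv e

/-- An end of the part in a face, not on the boundary of the caustic, is an end of the part in an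
adjacent face. -/
theorem exists_adjacent_faceEnd (hC : CausticData D E d κ v) {p : Lattice} (hf : HasFace D p)
    {z : M2} (hz : FaceEnd E κ v p z) (hb : z ∉ faceBoundary D E p) :
    ∃ q, q ≠ p ∧ HasFace D q ∧ FaceEnd E κ v q z := by
  obtain ⟨h₁, h₂, h₃, h₄, h₅, h₆⟩ := hf
  have h₁' : p - e₂ + e₂ ∈ D := by rwa [sub_add_cancel]
  have h₄' : p + e₁ - e₂ + e₂ ∈ D := by rwa [sub_add_cancel]
  obtain ⟨ra, ha, hca⟩ := hC.caustic _ h₁ h₁'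
  obtain ⟨rb, hrb, hcb⟩ := hC.caustic _ h₄ h₄'
  obtain ⟨rc, hc, hcc⟩ := hC.caustic _ h₅ h₆
  obtain ⟨rd, hd, hcd⟩ := hC.caustic _ h₂ h₃
  have ea := hC.ray_eq _ h₁ h₁'
  have eb := hC.ray_eq _ h₄ h₄'
  have ec := hC.ray_eq _ h₅ h₆
  have ed := hC.ray_eq _ h₂ h₃
  rw [sub_add_cancel] at ea eb
  have hu := hC.pos _ h₁ h₁'
  have hu' := hC.pos _ h₄ h₄'
  have hx' := hC.pos _ h₅ h₆
  have hx := hC.pos _ h₂ h₃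
  have hPpos : ∀ u, 0 < u → (normalRay E p u).PosDef := fun u hu =>
    normalRay_posDef (hC.surface_mem p h₂) hu
  have hQpos : ∀ u, 0 < u → (normalRay E (p + e₁) u).PosDef := fun u hu =>
    normalRay_posDef (hC.surface_mem _ h₅) hu
  have comm₁ : p - e₂ + e₁ = p + e₁ - e₂ := by abel
  have comm₂ : p + e₂ + e₁ = p + e₁ + e₂ := by abel
  have comm₃ : p - e₁ + e₁ = p := by abel
  have n₁ : p - e₁ ≠ p := by simp [e₁]
  have n₂ : p + e₁ ≠ p := by simp [e₁]
  have n₃ : p - e₂ ≠ p := by simp [e₂]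
  have n₄ : p + e₂ ≠ p := by simp [e₂]
  have hpos : ∀ {x x' : ℝ}, 0 < x → 0 < x' → (v - x) * (v - x') < 0 →
      (|v - x'| • normalRay E p x + |v - x| • normalRay E (p + e₁) x').PosDef :=
    fun hx hx' h => posDef_combination (hPpos _ hx) (hQpos _ hx') (abs_nonneg _) (abs_nonneg _)
      (.inr (abs_pos.2 fun h0 => by simp [h0] at h))
  simp only [faceBoundary, Set.mem_ofPred_eq, not_or, not_and] at hb
  obtain ⟨bb, bt, bl, br⟩ := hb
  obtain ⟨y, hy, rfl⟩ := hz
  -- The alternatives are the left, right, lower and upper side. Each leads to the opposite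
  -- alternative in the neighbouring face; for the last two, the caustic vertices have the same ray
  -- and parameter on both geodesics of their vertical edge.
  rcases hy with ⟨h, rfl⟩ | ⟨h, rfl⟩ | ⟨h, rfl⟩ | ⟨h, rfl⟩
  · refine ⟨p - e₁, n₁, ?_, ?_⟩
    · by_contra hn
      apply bl hn
      rw [hca, hcd, ea]
      exact lineRay_between_mem ha hd (hPpos v hC.v_pos) h
    · exact ⟨_, .inr (.inl ⟨by rwa [comm₃], by rw [comm₃]⟩), rfl⟩
  · refine ⟨p + e₁, n₂, ?_, ?_⟩
    · by_contra hn
      apply br hn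
      rw [hcb, hcc, eb]
      exact lineRay_between_mem hrb hc (hQpos v hC.v_pos) h
    · exact ⟨_, .inl ⟨h, rfl⟩, rfl⟩
  · refine ⟨p - e₂, n₃, ?_, ?_⟩
    · by_contra hn
      apply bb hn
      rw [hca, hcb, ea, eb]
      exact mem_geoSegment_of_cone ha hrb (abs_nonneg _) (abs_nonneg _) (hpos hu hu' h) rfl
    · exact ⟨_, .inr (.inr (.inr ⟨by rwa [comm₁], by rw [comm₁, ea, eb]⟩)), rfl⟩
  · refine ⟨p + e₂, n₄, ?_, ?_⟩
    · by_contra hn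
      apply bt hn
      rw [hcd, hcc]
      exact mem_geoSegment_of_cone hd hc (abs_nonneg _) (abs_nonneg _) (hpos hx hx' h) rfl
    · refine ⟨_, .inr (.inr (.inl ⟨?_, ?_⟩)), rfl⟩
      · rwa [comm₂, add_sub_cancel_right, add_sub_cancel_right]
      · rw [comm₂, add_sub_cancel_right, add_sub_cancel_right, ed, ec]

/-- The multigraph with one edge for every face that meets the corresponding edge of the parallel
surface. -/
def singularGraph (D : Set Lattice) (E : Lattice → M2) (κ : Lattice → ℝ) (v : ℝ) :
    Graph M2 Lattice where
  vertexSet := {z | ∃ p, HasFace D p ∧ ∃ x y, x ≠ y ∧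
    (∀ z, FaceEnd E κ v p z ↔ z = x ∨ z = y) ∧ FaceEnd E κ v p z}
  IsLink p x y := HasFace D p ∧ x ≠ y ∧ ∀ z, FaceEnd E κ v p z ↔ z = x ∨ z = y
  isLink_symm _ _ := ⟨fun _ _ h => ⟨h.1, h.2.1.symm, fun z => (h.2.2 z).trans or_comm⟩⟩
  eq_or_eq_of_isLink_of_isLink _ x _ _ _ h h' := (h'.2.2 x).1 ((h.2.2 x).2 (.inl rfl))
  left_mem_of_isLink p x y h := ⟨p, h.1, x, y, h.2.1, h.2.2, (h.2.2 x).2 (.inl rfl)⟩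

/-- The set of ends determines x and y up to order, and the segment is symmetric. -/
theorem singularPart_of_isLink (hC : CausticData D E d κ v)
    (hface : ∀ p, HasFace D p → FaceEmbedded E p) {p : Lattice} {x y : M2}
    (h : (singularGraph D E κ v).IsLink p x y) :
    x ∈ H3 ∧ y ∈ H3 ∧ singularPart D E d p = geoSegment x y := by
  obtain ⟨hf, hne, hends⟩ := h
  have hx := (hends x).2 (.inl rfl)
  have hy := (hends y).2 (.inr rfl)
  rcases singularPart_eq hC hf (hface p hf) with ⟨_, hno⟩ | ⟨x', y', hx', hy', _, hpart, he⟩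
  · exact absurd hx (hno x)
  · rcases (he x).1 hx with rfl | rfl <;> rcases (he y).1 hy with rfl | rfl
    · exact absurd rfl hne
    · exact ⟨hx', hy', hpart⟩
    · exact ⟨hy', hx', by rw [hpart, geoSegment_comm]⟩
    · exact absurd rfl hne

theorem exists_isLink (hC : CausticData D E d κ v) {p : Lattice} (hf : HasFace D p)
    (hemb : FaceEmbedded E p)
    (h : (singularPart D E d p).Nonempty ∨ ∃ z, FaceEnd E κ v p z) :
    ∃ x y, (singularGraph D E κ v).IsLink p x y := by
  rcases singularPart_eq hC hf hemb with ⟨hemp, hno⟩ | ⟨x, y, _, _, hne, _, he⟩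
  · rcases h with h | ⟨z, hz⟩
    · exact absurd hemp h.ne_empty
    · exact absurd hz (hno z)
  · exact ⟨x, y, hf, hne, he⟩

theorem inc_of_faceEnd (hC : CausticData D E d κ v) {p : Lattice} (hf : HasFace D p)
    (hemb : FaceEmbedded E p) {z : M2} (hz : FaceEnd E κ v p z) :
    (singularGraph D E κ v).Inc p z := by
  obtain ⟨x, y, h⟩ := exists_isLink hC hf hemb (.inr ⟨z, hz⟩)
  rcases (h.2.2 z).1 hz with rfl | rfl
  exacts [h.inc_left, h.inc_right]

theorem faceEnd_of_inc {p : Lattice} {z : M2} (h : (singularGraph D E κ v).Inc p z) :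
    HasFace D p ∧ FaceEnd E κ v p z := by
  obtain ⟨y, hf, _, h⟩ := h
  exact ⟨hf, (h z).2 (.inl rfl)⟩

theorem singularPart_eq_setOf (hC : CausticData D E d κ v)
    (hface : ∀ p, HasFace D p → FaceEmbedded E p) (p : Lattice) :
    singularPart D E d p =
      {z | ∃ i x y, (singularGraph D E κ v).IsLink i x y ∧ i = p ∧ z ∈ geoSegment x y} := by
  ext z
  constructor
  · intro hz
    obtain ⟨x, y, h⟩ := exists_isLink hC hz.1 (hface p hz.1) (.inl ⟨z, hz⟩)
    exact ⟨p, x, y, h, rfl, (singularPart_of_isLink hC hface h).2.2 ▸ hz⟩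
  · rintro ⟨_, x, y, h, rfl, hz⟩
    rw [(singularPart_of_isLink hC hface h).2.2]
    exact hz

theorem isGeodesicGraph_singularGraph (hC : CausticData D E d κ v)
    (hface : ∀ p, HasFace D p → FaceEmbedded E p) :
    IsGeodesicGraph (singularSet D E d) (singularPart D E d) (singularGraph D E κ v) id where
  vertex_mem := by
    rintro z ⟨p, hf, x, y, hne, he, hz⟩
    obtain ⟨hx, hy, hpart⟩ := singularPart_of_isLink (p := p) hC hface ⟨hf, hne, he⟩
    refine ⟨p, ?_⟩
    rw [hpart]
    rcases (he z).1 hz with rfl | rfl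
    exacts [left_mem_geoSegment hx, right_mem_geoSegment hy]
  ends_ne _ _ _ h := h.2.1
  union_eq := by
    ext z
    constructor
    · rintro ⟨p, hz⟩
      rw [singularPart_eq_setOf hC hface p] at hz
      obtain ⟨i, x, y, h, _, hz⟩ := hz
      exact ⟨i, x, y, h, hz⟩
    · rintro ⟨i, x, y, h, hz⟩
      exact ⟨i, (singularPart_of_isLink hC hface h).2.2 ▸ hz⟩
  part_eq := singularPart_eq_setOf hC hface
  -- Edges are their own labels, so no two edges share a label.
  finite p := (Set.finite_singleton p).subset fun _ h => h.2
  inter _ _ _ _ _ _ _ _ hij h := absurd h hij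
  not_isolated := by
    rintro z ⟨p, hf, _, _, _, _, hz⟩
    exact ⟨p, inc_of_faceEnd hC hf (hface p hf) hz⟩

theorem two_le_encard_incidenceSet (hC : CausticData D E d κ v)
    (hface : ∀ p, HasFace D p → FaceEmbedded E p) {p : Lattice} {z : M2}
    (h : (singularGraph D E κ v).Inc p z) (hb : z ∉ faceBoundary D E p) :
    2 ≤ ((singularGraph D E κ v).incidenceSet z).encard := by
  obtain ⟨hf, hz⟩ := faceEnd_of_inc h
  obtain ⟨q, hqp, hfq, hzq⟩ := exists_adjacent_faceEnd hC hf hz hb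
  rw [← Set.encard_pair hqp]
  refine Set.encard_le_encard ?_
  rintro i (rfl | rfl)
  exacts [inc_of_faceEnd hC hfq (hface _ hfq) hzq, h]

end Faces

end DiscreteFlat

theorem mainTheorem5
    (D : Set DiscreteFlat.Lattice) (g : DiscreteFlat.Lattice → ℂ)
    (α : Sym2 DiscreteFlat.Lattice → ℝ) (lam : ℝ) (E : DiscreteFlat.Lattice → DiscreteFlat.M2)
    (hα : DiscreteFlat.IsCrossRatioFactorizing D g α)
    (hg : ∀ p ∈ D, ∀ q ∈ D, DiscreteFlat.IsStep p q → g q - g p ≠ 0)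
    (hquad : DiscreteFlat.HasEmbeddedQuads D g)
    (hlam : lam ≠ 0)
    (hhor : ∀ p, p ∈ D → p + DiscreteFlat.e₁ ∈ D → 0 < lam * α s(p, p + DiscreteFlat.e₁))
    (hver : ∀ p, p ∈ D → p + DiscreteFlat.e₂ ∈ D → lam * α s(p, p + DiscreteFlat.e₂) < 0)
    (hE : DiscreteFlat.IsLift D g α lam E)
    (hH3 : ∀ p ∈ D, DiscreteFlat.surface E p ∈ DiscreteFlat.H3)
    (d : ℝ) (hd : 0 < d)
    (hadj : ∀ p ∈ D, ∀ q ∈ D, DiscreteFlat.IsStep p q →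
      DiscreteFlat.parallel E d p ≠ DiscreteFlat.parallel E d q)
    (hface : ∀ p, DiscreteFlat.HasFace D p → DiscreteFlat.FaceEmbedded E p) :
    ∃ (ι : Type) (G : Graph DiscreteFlat.M2 ι) (lab : ι → DiscreteFlat.Lattice),
      DiscreteFlat.IsGeodesicGraph (DiscreteFlat.singularSet D E d)
        (DiscreteFlat.singularPart D E d) G lab ∧
      ∀ v ∈ G.vertexSet,
        (∃ i, G.Inc i v ∧ v ∉ DiscreteFlat.faceBoundary D E (lab i)) →
          2 ≤ (G.incidenceSet v).encard := by
  obtain ⟨κ, v, hC⟩ := DiscreteFlat.exists_causticData hg hhor hver hE hH3 hd hadj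
  exact ⟨DiscreteFlat.Lattice, DiscreteFlat.singularGraph D E κ v, id,
    DiscreteFlat.isGeodesicGraph_singularGraph hC hface, fun _ _ ⟨_, hi, hb⟩ =>
      DiscreteFlat.two_le_encard_incidenceSet hC hface hi hb⟩
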